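/- Let $\frac12<H<1$ and $d\in\mathbb{N}$, and let $B=(B_t)_{t\ge 0}$ be a $d$-dimensional fractional Brownian motion with Hurst exponent $H$ on a probability space $(\Omega,\mathcal{F},\mathbb{P})$, that is, a centred Gaussian process with (almost surely) continuous paths and $\mathbb{E}[B^{(i)}_sB^{(j)}_t]=\frac12\{t^{2H}+s^{2H}-|t-s|^{2H}\}\delta_{ij}$. Let $0<T<\infty$, let $g:[0,T]\times\mathbb{R}^d\to\mathbb{R}^d$ be a Borel function, $Y_s=g(s,B_s)$ and $Y^{\otimes 2}(s,t)=Y_s\otimes Y_t=(Y^i_sY^j_t)_{i,j}$, where matrices carry the Frobenius norm. Let $\max\{\frac{1}{2-2H},\frac{1}{2H-1}\}<p\le\infty$, assume that $Y^{\otimes 2}\in L^p(\Omega\times[0,T]^2;\mathbb{R}^{d\times d})$ with respect to $d\mathbb{P}\times ds\,dt$, and let $q$ be the conjugate exponent of $p$ (so that $1\le q<\min\{\frac{1}{2-2H},\frac{1}{2H-1}\}$). Then for every $(u,v)\in[0,T]^2$ the forward integral $$\int_u^v Y_r\,d^-B_r:=\lim_{\varepsilon\downarrow0}\frac1\varepsilon\int_u^v\langle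 Y_s,B_{s+\varepsilon}-B_s\rangle\,ds$$ exists as a limit in $L^2(\mathbb{P})$, and $$\Big\|\int_u^vY_r\,d^-B_r\Big\|_2^2\le C\,\|Y^{\otimes 2}\|_p\,|v-u|^{2(H-1)+\frac2q},$$ where $\|Y^{\otimes2}\|_p$ is the norm in $L^p(\Omega\times[0,T]^2;\mathbb{R}^{d\times d})$, and $C>0$ is a constant which depends only on $H$, $q$ and $d$. -/

import Mathlib

open MeasureTheory ProbabilityTheory Filter Topology
open scoped NNReal ENNReal

/-- The covariance function `R(s,t) = (s^{2H} + t^{2H} - |t-s|^{2H}) / 2` of fractional Brownian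
motion with Hurst exponent `H`. -/
noncomputable def fbmCov (H : ℝ) (s t : ℝ≥0) : ℝ :=
  ((t : ℝ) ^ (2 * H) + (s : ℝ) ^ (2 * H) - |(t : ℝ) - (s : ℝ)| ^ (2 * H)) / 2

/-- `B` is a `d`-dimensional fractional Brownian motion with Hurst exponent `H` on the probability
space `(Ω, P)`: a centred Gaussian process in `ℝ^d` with covariance `R(s,t) δ_{ij}` and almost
surely continuous paths. -/
structure IsFBM {Ω : Type*} [MeasurableSpace Ω] (P : Measure Ω) (H : ℝ) (d : ℕ)
    (B : ℝ≥0 → Ω → EuclideanSpace ℝ (Fin d)) : Prop where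
  isGaussianProcess : IsGaussianProcess B P
  centered : ∀ (t : ℝ≥0) (i : Fin d), ∫ ω, B t ω i ∂P = 0
  covariance : ∀ (s t : ℝ≥0) (i j : Fin d),
    ∫ ω, B s ω i * B t ω j ∂P = if i = j then fbmCov H s t else 0
  continuous_paths : ∀ᵐ ω ∂P, Continuous fun t => B t ω

/-- The integrand process `Y_s = g(s, B_s)`, for `0 ≤ s`. -/
def integrandProcess {Ω : Type*} {d : ℕ}
    (g : ℝ → EuclideanSpace ℝ (Fin d) → EuclideanSpace ℝ (Fin d))
    (B : ℝ≥0 → Ω → EuclideanSpace ℝ (Fin d)) (s : ℝ) (ω : Ω) : EuclideanSpace ℝ (Fin d) :=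
  g s (B s.toNNReal ω)

/-- The tensor product `a ⊗ b = (a_i b_j)_{ij}`, as an element of the space of `d × d` matrices with
the Frobenius (Euclidean) norm. -/
def tensor {d : ℕ} (a b : EuclideanSpace ℝ (Fin d)) : EuclideanSpace ℝ (Fin d × Fin d) :=
  WithLp.toLp 2 fun ij => a ij.1 * b ij.2

/-- The two-parameter process `Y^{⊗2}(s,t) = Y_s ⊗ Y_t`, as a function on `Ω × ℝ²`. -/
def tensorSquare {Ω : Type*} {d : ℕ} (Y : ℝ → Ω → EuclideanSpace ℝ (Fin d)) :
    Ω × (ℝ × ℝ) → EuclideanSpace ℝ (Fin d × Fin d) :=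
  fun x => tensor (Y x.2.1 x.1) (Y x.2.2 x.1)

/-- The measure `dP × ds dt` on `Ω × [0,T]²`. -/
noncomputable def squareMeasure {Ω : Type*} [MeasurableSpace Ω] (P : Measure Ω) (T : ℝ) :
    Measure (Ω × (ℝ × ℝ)) :=
  P.prod ((volume : Measure (ℝ × ℝ)).restrict (Set.Icc 0 T ×ˢ Set.Icc 0 T))

/-- The integrand `s ↦ ⟨Y_s, B_{s+ε} - B_s⟩` of the forward approximation. -/
noncomputable def forwardIntegrand {Ω : Type*} {d : ℕ}
    (B : ℝ≥0 → Ω → EuclideanSpace ℝ (Fin d)) (Y : ℝ → Ω → EuclideanSpace ℝ (Fin d))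
    (ε : ℝ) (ω : Ω) (s : ℝ) : ℝ :=
  inner ℝ (Y s ω) (B (s + ε).toNNReal ω - B s.toNNReal ω)

/-- The forward approximation `(1/ε) ∫_u^v ⟨Y_s, B_{s+ε} - B_s⟩ ds`; for `v < u` the integral is
oriented, `∫_u^v = - ∫_v^u`. -/
noncomputable def forwardApprox {Ω : Type*} {d : ℕ}
    (B : ℝ≥0 → Ω → EuclideanSpace ℝ (Fin d)) (Y : ℝ → Ω → EuclideanSpace ℝ (Fin d))
    (u v ε : ℝ) (ω : Ω) : ℝ :=
  ε⁻¹ * ∫ s in u..v, forwardIntegrand B Y ε ω s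

/-- `I` is (a version of) the forward integral `∫_u^v Y d⁻B`: the forward approximations are well
defined square integrable random variables for all `ε > 0`, and converge to `I` in `L²(P)`
as `ε ↓ 0`. -/
structure IsForwardIntegral {Ω : Type*} [MeasurableSpace Ω] (P : Measure Ω) {d : ℕ}
    (B : ℝ≥0 → Ω → EuclideanSpace ℝ (Fin d)) (Y : ℝ → Ω → EuclideanSpace ℝ (Fin d))
    (u v : ℝ) (I : Ω → ℝ) : Prop where
  memLp_limit : MemLp I 2 P
  intervalIntegrable : ∀ ε : ℝ, 0 < ε →
    ∀ᵐ ω ∂P, IntervalIntegrable (forwardIntegrand B Y ε ω) volume u v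
  memLp_approx : ∀ ε : ℝ, 0 < ε → MemLp (forwardApprox B Y u v ε) 2 P
  tendsto : Tendsto (fun ε => eLpNorm (forwardApprox B Y u v ε - I) 2 P) (𝓝[>] 0) (𝓝 0)

/-! Convergence in L² follows once the mixed second moments `E[J_ε J_δ]` of the forward
approximations converge as `(ε, δ) → (0, 0)`: in a Hilbert space this forces the Cauchy property and
identifies the squared norm of the limit (`exists_tendsto_of_tendsto_inner`). By Fubini such a
moment is a double integral over `[u,v]²` of `(εδ)⁻¹ E[Y_s^i Y_t^j ΔB_s^i ΔB_t^j]`, so a pointwise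
limit of this kernel and an integrable majorant suffice.

The weight `Y_s^i Y_t^j` is a function of `(B_s, B_t)` only. With `m = min s t` and `M = max s t`,
regress both increments on the unit-variance variables `B_m / m^H` and `(B_M - B_m) / (M - m)^H`.
The residuals are independent of the regressors, so the expectation becomes a combination of
weighted second moments of the regressors, with coefficients depending on `ε` and `δ`, plus `E[Y_s^i
Y_t^j]` times the residual covariance (`IsFBM.integral_mul_increments`).

Two covariance estimates control everything. The regressors have correlation at most `2H - 1 < 1`
(`abs_stdCorr_le`), so the normal equations are uniformly well conditioned and the coefficients are
of order `ε (m^(H-1) + (M-m)^(H-1))`. The covariance of the two increments is of order `εδ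
|t-s|^(2H-2)`, even when they overlap (`abs_incCov_incCov_le`). After division by `εδ` the kernel is
dominated by `W(s,t) E[‖Y_s ⊗ Y_t‖ (1 + regSq)]` with `W = s^(2H-2) + t^(2H-2) + |t-s|^(2H-2)`.

Since `p > 1/(2H-1)` means `(2-2H) q < 1`, the weight `W` is in `L^q` of the square, with norm of
order `(v-u)^(2(H-1)+2/q)`. Gaussian moments of `regSq` do not depend on `(s,t)`, so Hölder's
inequality yields both the majorant and the final estimate. -/

/-! ### Increment estimates for odd powers. -/

/-- The odd power function `x ↦ sgn(x) |x|^γ`. -/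
noncomputable def oddPow (γ x : ℝ) : ℝ := |x| ^ (γ - 1) * x

lemma oddPow_neg (γ x : ℝ) : oddPow γ (-x) = -oddPow γ x := by simp [oddPow]

lemma oddPow_of_nonneg {γ x : ℝ} (hγ : 0 < γ) (hx : 0 ≤ x) : oddPow γ x = x ^ γ := by
  rcases hx.eq_or_lt with rfl | hx
  · simp [oddPow, Real.zero_rpow hγ.ne']
  · rw [oddPow, abs_of_pos hx]
    nth_rw 2 [← Real.rpow_one x]
    rw [← Real.rpow_add hx]; simp

lemma oddPow_of_nonpos {γ x : ℝ} (hγ : 0 < γ) (hx : x ≤ 0) : oddPow γ x = -(-x) ^ γ := by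
  rw [← oddPow_of_nonneg hγ (neg_nonneg.2 hx), oddPow_neg, neg_neg]

lemma abs_rpow_sub_rpow_le {γ x y : ℝ} (hγ : 0 < γ) (hγ' : γ ≤ 1) (hx : 0 ≤ x) (hy : 0 ≤ y) :
    |x ^ γ - y ^ γ| ≤ |x - y| ^ γ := by
  wlog h : y ≤ x generalizing x y
  · rw [abs_sub_comm, abs_sub_comm x y]; exact this hy hx (le_of_not_ge h)
  have h1 := Real.rpow_le_rpow hy h hγ.le
  rw [abs_of_nonneg (sub_nonneg.2 h1), abs_of_nonneg (sub_nonneg.2 h)]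
  have := Real.rpow_add_le_add_rpow (sub_nonneg.2 h) hy hγ.le hγ'
  rw [sub_add_cancel] at this
  linarith

/-- For arguments of the same sign this is subadditivity of the power, with constant 1. For opposite
signs each of the two terms is at most `|x - y| ^ γ`, whence the 2. -/
lemma abs_oddPow_sub_le {γ : ℝ} (hγ : 0 < γ) (hγ' : γ ≤ 1) (x y : ℝ) :
    |oddPow γ x - oddPow γ y| ≤ 2 * |x - y| ^ γ := by
  have key : ∀ x y : ℝ, 0 ≤ y → |oddPow γ x - oddPow γ y| ≤ 2 * |x - y| ^ γ := by
    intro x y hy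
    have hnn : 0 ≤ |x - y| ^ γ := Real.rpow_nonneg (abs_nonneg _) _
    rcases le_total 0 x with hx | hx
    · rw [oddPow_of_nonneg hγ hx, oddPow_of_nonneg hγ hy]
      linarith [abs_rpow_sub_rpow_le hγ hγ' hx hy]
    · rw [oddPow_of_nonpos hγ hx, oddPow_of_nonneg hγ hy]
      have h1 : (-x) ^ γ ≤ |x - y| ^ γ :=
        Real.rpow_le_rpow (by linarith) (by rw [abs_of_nonpos (by linarith)]; linarith) hγ.le
      have h2 : y ^ γ ≤ |x - y| ^ γ :=
        Real.rpow_le_rpow hy (by rw [abs_of_nonpos (by linarith)]; linarith) hγ.le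
      have h3 : 0 ≤ (-x) ^ γ := Real.rpow_nonneg (by linarith) _
      have h4 : 0 ≤ y ^ γ := Real.rpow_nonneg hy _
      rw [abs_of_nonpos (by linarith)]; linarith
  rcases le_total 0 y with hy | hy
  · exact key x y hy
  · have := key (-x) (-y) (by linarith)
    rw [oddPow_neg, oddPow_neg] at this
    rwa [← neg_sub', abs_neg, ← neg_sub', abs_neg] at this

/-- A mean value estimate whose weight sits at the endpoint `y` alone, valid even when the segment
crosses the singularity at 0. Same signs give constant 1 because `z ^ (γ - 1)` decreases; across 0
both terms are bounded by `|x - y| * |y| ^ (γ - 1)`. -/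
lemma abs_oddPow_sub_le_mul {γ : ℝ} (hγ : 0 < γ) (hγ' : γ ≤ 1) (x : ℝ) {y : ℝ} (hy : y ≠ 0) :
    |oddPow γ x - oddPow γ y| ≤ 2 * |x - y| * |y| ^ (γ - 1) := by
  have key : ∀ x y : ℝ, 0 < y → |oddPow γ x - oddPow γ y| ≤ 2 * |x - y| * |y| ^ (γ - 1) := by
    intro x y hy
    rw [abs_of_pos hy]
    have hyp : 0 < y ^ (γ - 1) := Real.rpow_pos_of_pos hy _
    have hyy : y ^ γ = y ^ (γ - 1) * y := by
      nth_rw 3 [← Real.rpow_one y]; rw [← Real.rpow_add hy]; simp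
    rw [oddPow_of_nonneg hγ hy.le, hyy]
    have hsplit : ∀ z : ℝ, 0 < z → z ^ γ = z ^ (γ - 1) * z := fun z hz => by
      nth_rw 3 [← Real.rpow_one z]; rw [← Real.rpow_add hz]; simp
    rcases le_total y x with hx | hx
    · have hx0 : 0 < x := hy.trans_le hx
      rw [oddPow_of_nonneg hγ hx0.le, hsplit x hx0]
      have h1 : x ^ (γ - 1) ≤ y ^ (γ - 1) :=
        Real.rpow_le_rpow_of_nonpos hy hx (by linarith)
      have h2 : y ^ (γ - 1) * y ≤ x ^ (γ - 1) * x := by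
        rw [← hsplit x hx0, ← hyy]; exact Real.rpow_le_rpow hy.le hx hγ.le
      rw [abs_of_nonneg (by linarith), abs_of_nonneg (by linarith)]
      nlinarith [mul_nonneg (sub_nonneg.2 hx) hyp.le, mul_nonneg (sub_nonneg.2 h1) hx0.le]
    · rcases lt_or_ge 0 x with hx0 | hx0
      · rw [oddPow_of_nonneg hγ hx0.le, hsplit x hx0]
        have h1 : y ^ (γ - 1) ≤ x ^ (γ - 1) :=
          Real.rpow_le_rpow_of_nonpos hx0 hx (by linarith)
        have h2 : x ^ (γ - 1) * x ≤ y ^ (γ - 1) * y := by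
          rw [← hsplit x hx0, ← hyy]; exact Real.rpow_le_rpow hx0.le hx hγ.le
        rw [abs_of_nonpos (by linarith), abs_of_nonpos (by linarith)]
        nlinarith [mul_nonneg (sub_nonneg.2 hx) hyp.le, mul_nonneg (sub_nonneg.2 h1) hx0.le]
      · rw [oddPow_of_nonpos hγ hx0, abs_of_nonpos (a := x - y) (by linarith)]
        have h3 : 0 ≤ (-x) ^ γ := Real.rpow_nonneg (by linarith) _
        have h4 : (-x) ^ γ ≤ (y - x) * y ^ (γ - 1) := by
          rcases le_total (-x) y with h | h
          · have := Real.rpow_le_rpow (neg_nonneg.2 hx0) h hγ.le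
            nlinarith [mul_nonneg (neg_nonneg.2 hx0) hyp.le]
          · have hx1 : 0 < -x := hy.trans_le h
            rw [hsplit _ hx1]
            have := Real.rpow_le_rpow_of_nonpos hy h (show γ - 1 ≤ 0 by linarith)
            nlinarith [mul_nonneg hy.le hyp.le]
        rw [abs_of_nonpos (by nlinarith)]
        nlinarith [mul_nonneg (neg_nonneg.2 hx0) hyp.le]
  rcases lt_or_gt_of_ne hy with hy | hy
  · have := key (-x) (-y) (by linarith)
    rw [oddPow_neg, oddPow_neg, abs_neg y] at this
    rwa [← neg_sub', abs_neg, ← neg_sub', abs_neg] at this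
  · exact key x y hy

lemma hasDerivAt_oddPow {γ : ℝ} (hγ : 0 < γ) {x : ℝ} (hx : x ≠ 0) :
    HasDerivAt (oddPow γ) (γ * |x| ^ (γ - 1)) x := by
  rcases lt_or_gt_of_ne hx with h | h
  · have h1 : HasDerivAt (fun y : ℝ => -(-y) ^ γ) (γ * |x| ^ (γ - 1)) x := by
      have := ((hasDerivAt_neg x).rpow_const (p := γ) (Or.inl (by linarith))).neg
      rw [abs_of_neg h]
      exact this.congr_deriv (by ring)
    refine h1.congr_of_eventuallyEq ?_
    filter_upwards [Iio_mem_nhds h] with y hy using oddPow_of_nonpos hγ (le_of_lt hy)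
  · have h1 : HasDerivAt (fun y : ℝ => y ^ γ) (γ * |x| ^ (γ - 1)) x := by
      rw [abs_of_pos h]; exact Real.hasDerivAt_rpow_const (Or.inl hx)
    refine h1.congr_of_eventuallyEq ?_
    filter_upwards [Ioi_mem_nhds h] with y hy using oddPow_of_nonneg hγ (le_of_lt hy)

lemma continuous_oddPow {γ : ℝ} (hγ : 0 < γ) (hγ' : γ ≤ 1) : Continuous (oddPow γ) := by
  rw [continuous_iff_continuousAt]
  intro x
  rw [ContinuousAt, tendsto_iff_norm_sub_tendsto_zero]
  refine squeeze_zero (fun _ => norm_nonneg _) (fun y => abs_oddPow_sub_le hγ hγ' y x) ?_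
  have : ContinuousAt (fun y : ℝ => 2 * |y - x| ^ γ) x :=
    (ContinuousAt.rpow_const (by fun_prop) (Or.inr hγ.le)).const_mul 2
  simpa [ContinuousAt, Real.zero_rpow hγ.ne'] using this

/-- Continuous functions with nonnegative derivative away from the origin are monotone. -/
lemma monotone_of_hasDerivAt_nonneg_of_ne {f f' : ℝ → ℝ} (hc : Continuous f)
    (hf : ∀ x, x ≠ 0 → HasDerivAt f (f' x) x) (h0 : ∀ x, x ≠ 0 → 0 ≤ f' x) : Monotone f := by
  have h1 : MonotoneOn f (Set.Iic 0) := by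
    refine monotoneOn_of_deriv_nonneg (convex_Iic 0) hc.continuousOn ?_ ?_
    · intro x hx
      rw [interior_Iic] at hx
      exact (hf x (ne_of_lt hx)).differentiableAt.differentiableWithinAt
    · intro x hx
      rw [interior_Iic] at hx
      rw [(hf x (ne_of_lt hx)).deriv]; exact h0 x (ne_of_lt hx)
  have h2 : MonotoneOn f (Set.Ici 0) := by
    refine monotoneOn_of_deriv_nonneg (convex_Ici 0) hc.continuousOn ?_ ?_
    · intro x hx
      rw [interior_Ici] at hx
      exact (hf x (ne_of_gt hx)).differentiableAt.differentiableWithinAt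
    · intro x hx
      rw [interior_Ici] at hx
      rw [(hf x (ne_of_gt hx)).deriv]; exact h0 x (ne_of_gt hx)
  exact h1.Iic_union_Ici h2

lemma monotone_oddPow {γ : ℝ} (hγ : 0 < γ) (hγ' : γ ≤ 1) : Monotone (oddPow γ) :=
  monotone_of_hasDerivAt_nonneg_of_ne (continuous_oddPow hγ hγ')
    (fun _ hx => hasDerivAt_oddPow hγ hx) fun _ _ => by positivity

/-- `∫_u^v |s - x|^{-c} ds ≤ C (v - u)^{1-c}`, uniformly in `x`. -/
lemma lintegral_Icc_abs_sub_rpow_le {γ : ℝ} (hγ : 0 < γ) (hγ' : γ ≤ 1) {u v : ℝ} (huv : u ≤ v)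
    (x : ℝ) :
    ∫⁻ s in Set.Icc u v, ENNReal.ofReal (|s - x| ^ (γ - 1)) ≤
      ENNReal.ofReal (2 / γ * (v - u) ^ γ) := by
  -- Off the singular point the integrand is the derivative of the monotone function `γ⁻¹ * oddPow γ
  -- (s - x)`, so its integral is the measure of an image; no improper integral has to be split at
  -- `x`.
  have hae : (Set.Icc u v \ {x} : Set ℝ) =ᵐ[volume] Set.Icc u v := by
    exact sdiff_null_ae_eq_self (by simp)
  rw [← setLIntegral_congr hae]
  have hder : ∀ s ∈ (Set.Icc u v \ {x} : Set ℝ), HasDerivWithinAt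
      (fun s => γ⁻¹ * oddPow γ (s - x)) (|s - x| ^ (γ - 1)) (Set.Icc u v \ {x}) s := by
    intro s hs
    have hne : s - x ≠ 0 := sub_ne_zero.2 hs.2
    have := ((hasDerivAt_oddPow hγ hne).comp_sub_const s x).const_mul γ⁻¹
    rw [inv_mul_cancel_left₀ hγ.ne'] at this
    exact this.hasDerivWithinAt
  have hmono : Monotone (fun s => γ⁻¹ * oddPow γ (s - x)) := fun a b hab =>
    mul_le_mul_of_nonneg_left (monotone_oddPow hγ hγ' (sub_le_sub_right hab x)) (by positivity)
  rw [lintegral_deriv_eq_volume_image_of_monotoneOn (measurableSet_Icc.diff (by simp)) hder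
    (hmono.monotoneOn _)]
  refine (measure_mono (t := Set.Icc (γ⁻¹ * oddPow γ (u - x)) (γ⁻¹ * oddPow γ (v - x))) ?_).trans ?_
  · rintro _ ⟨s, hs, rfl⟩
    exact ⟨hmono hs.1.1, hmono hs.1.2⟩
  · rw [Real.volume_Icc]
    refine ENNReal.ofReal_le_ofReal ?_
    have := (le_abs_self _).trans (abs_oddPow_sub_le hγ hγ' (v - x) (u - x))
    rw [sub_sub_sub_cancel_right, abs_of_nonneg (sub_nonneg.2 huv)] at this
    rw [← mul_sub, div_eq_inv_mul, mul_assoc]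
    exact mul_le_mul_of_nonneg_left this (by positivity)

/-! ### Covariances of fractional Brownian increments. -/

/-- The covariance of the increments `B_b - B_a` and `B_d - B_c` of fractional Brownian motion. -/
noncomputable def incCov (H a b c d : ℝ) : ℝ :=
  (|b - c| ^ (2 * H) + |a - d| ^ (2 * H) - |b - d| ^ (2 * H) - |a - c| ^ (2 * H)) / 2

lemma incCov_comm (H a b c d : ℝ) : incCov H c d a b = incCov H a b c d := by
  simp only [incCov, abs_sub_comm d, abs_sub_comm c]; ring

lemma hasDerivAt_abs_rpow_two_mul {H : ℝ} (hH : 1 / 2 < H) (x : ℝ) :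
    HasDerivAt (fun x : ℝ => |x| ^ (2 * H)) (2 * H * oddPow (2 * H - 1) x) x := by
  refine (hasDerivAt_abs_rpow x (by linarith : 1 < 2 * H)).congr_deriv ?_
  rw [oddPow]; ring_nf

lemma incCov_eq (H s ε c d : ℝ) : incCov H s (s + ε) c d =
    ((fun x => |x - c| ^ (2 * H) - |x - d| ^ (2 * H)) (s + ε) -
      (fun x => |x - c| ^ (2 * H) - |x - d| ^ (2 * H)) s) / 2 := by
  simp only [incCov]; ring

lemma hasDerivAt_abs_sub_rpow_sub {H : ℝ} (hH : 1 / 2 < H) (c d x : ℝ) :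
    HasDerivAt (fun x => |x - c| ^ (2 * H) - |x - d| ^ (2 * H))
      (2 * H * (oddPow (2 * H - 1) (x - c) - oddPow (2 * H - 1) (x - d))) x := by
  refine (((hasDerivAt_abs_rpow_two_mul hH (x - c)).comp_sub_const x c).sub
    ((hasDerivAt_abs_rpow_two_mul hH (x - d)).comp_sub_const x d)).congr_deriv (by ring)

/-- Mean value inequality in the first increment: the derivative is a difference of odd powers of
order `2H - 1 ≤ 1`, hence bounded uniformly in the base point by Hölder continuity. -/
lemma abs_incCov_le {H : ℝ} (hH : 1 / 2 < H) (hH' : H < 1) (s c d : ℝ) {ε : ℝ} (hε : 0 ≤ ε) :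
    |incCov H s (s + ε) c d| ≤ 2 * ε * |d - c| ^ (2 * H - 1) := by
  have hb : ∀ x ∈ (Set.univ : Set ℝ),
      ‖2 * H * (oddPow (2 * H - 1) (x - c) - oddPow (2 * H - 1) (x - d))‖
        ≤ 4 * |d - c| ^ (2 * H - 1) := by
    intro x _
    have h1 := abs_oddPow_sub_le (γ := 2 * H - 1) (by linarith) (by linarith) (x - c) (x - d)
    rw [sub_sub_sub_cancel_left] at h1
    rw [norm_mul, Real.norm_eq_abs, Real.norm_eq_abs, abs_of_pos (by linarith : 0 < 2 * H)]
    have h2 : 0 ≤ |d - c| ^ (2 * H - 1) := by positivity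
    nlinarith [abs_nonneg (oddPow (2 * H - 1) (x - c) - oddPow (2 * H - 1) (x - d))]
  have := convex_univ.norm_image_sub_le_of_norm_hasDerivWithin_le
    (fun x _ => (hasDerivAt_abs_sub_rpow_sub hH c d x).hasDerivWithinAt) hb
    (Set.mem_univ s) (Set.mem_univ (s + ε))
  rw [incCov_eq, abs_div, abs_of_pos (by norm_num : (0 : ℝ) < 2), div_le_iff₀ (by norm_num)]
  rw [add_sub_cancel_left, Real.norm_eq_abs, Real.norm_eq_abs, abs_of_nonneg hε] at this
  linarith

lemma tendsto_incCov_div {H : ℝ} (hH : 1 / 2 < H) (s c d : ℝ) :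
    ∃ L, Tendsto (fun ε => incCov H s (s + ε) c d / ε) (𝓝[>] 0) (𝓝 L) := by
  have h := (hasDerivAt_abs_sub_rpow_sub hH c d s).tendsto_slope_zero_right.div_const 2
  refine ⟨_, h.congr fun ε => ?_⟩
  rw [incCov_eq, smul_eq_mul]; ring

/-- The covariance is half a mixed second difference of `|x| ^ (2H)`, of size `εδ` times the second
derivative near `s - t`. No separation of the two increments is required, which makes this usable as
a majorant on the whole square. -/
lemma abs_incCov_incCov_le {H : ℝ} (hH : 1 / 2 < H) (hH' : H < 1) {s t : ℝ} (hst : s ≠ t)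
    {ε δ : ℝ} (hε : 0 ≤ ε) (hδ : 0 ≤ δ) :
    |incCov H s (s + ε) t (t + δ)| ≤
      8 / (2 * H - 1) * ε * δ * |t - s| ^ (2 * H - 2) := by
  set γ := 2 * H - 1 with hγdef
  have hγ : 0 < γ := by linarith
  have hγ' : γ ≤ 1 := by linarith
  set h : ℝ → ℝ := fun x => |x| ^ (2 * H) - |x - δ| ^ (2 * H) with hh
  have hderiv : ∀ x, HasDerivAt h (2 * H * (oddPow γ x - oddPow γ (x - δ))) x := fun x => by
    simpa [hh] using hasDerivAt_abs_sub_rpow_sub hH 0 δ x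
  have hbd : ∀ x, x ≠ 0 →
      |2 * H * (oddPow γ x - oddPow γ (x - δ))| ≤ 4 * δ * |x| ^ (γ - 1) := by
    intro x hx
    have := abs_oddPow_sub_le_mul hγ hγ' (x - δ) hx
    rw [sub_sub_cancel_left, abs_neg, abs_of_nonneg hδ, abs_sub_comm] at this
    rw [abs_mul, abs_of_pos (by linarith : 0 < 2 * H)]
    have h2 : 0 ≤ |x| ^ (γ - 1) := by positivity
    nlinarith [abs_nonneg (oddPow γ x - oddPow γ (x - δ)), mul_nonneg hδ h2]
  have hcont : Continuous h := continuous_iff_continuousAt.2 fun x => (hderiv x).continuousAt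
  -- The bound on `h'` is singular at 0, so the mean value inequality does not apply directly. Since
  -- `4δ/γ * oddPow γ` has exactly this bound as derivative, adding or subtracting `h` leaves a
  -- monotone function, and increments of `h` are controlled by those of `oddPow γ`.
  have hm1 : Monotone fun x => 4 * δ / γ * oddPow γ x + h x := by
    refine monotone_of_hasDerivAt_nonneg_of_ne
      (((continuous_oddPow hγ hγ').const_mul _).add hcont)
      (fun x hx => ((hasDerivAt_oddPow hγ hx).const_mul _).add (hderiv x)) fun x hx => ?_
    have := neg_le_of_abs_le (hbd x hx)
    rw [← mul_assoc, div_mul_cancel₀ _ hγ.ne']; linarith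
  have hm2 : Monotone fun x => 4 * δ / γ * oddPow γ x - h x := by
    refine monotone_of_hasDerivAt_nonneg_of_ne
      (((continuous_oddPow hγ hγ').const_mul _).sub hcont)
      (fun x hx => ((hasDerivAt_oddPow hγ hx).const_mul _).sub (hderiv x)) fun x hx => ?_
    have := le_of_abs_le (hbd x hx)
    rw [← mul_assoc, div_mul_cancel₀ _ hγ.ne']; linarith
  have hle : s - t ≤ s - t + ε := by linarith
  have e1 := hm1 hle
  have e2 := hm2 hle
  have hodd := (le_abs_self _).trans
    (abs_oddPow_sub_le_mul hγ hγ' (s - t + ε) (sub_ne_zero.2 hst))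
  rw [add_sub_cancel_left, abs_of_nonneg hε, abs_sub_comm] at hodd
  have hγ2 : γ - 1 = 2 * H - 2 := by rw [hγdef]; ring
  rw [hγ2] at hodd
  have hcoef : 0 ≤ 4 * δ / γ := by positivity
  have hfin : |h (s - t + ε) - h (s - t)| ≤ 4 * δ / γ * (2 * ε * |t - s| ^ (2 * H - 2)) := by
    refine le_trans ?_ (mul_le_mul_of_nonneg_left hodd hcoef)
    simp only at e1 e2
    rw [abs_le]; constructor <;> linarith
  have hinc : incCov H s (s + ε) t (t + δ) = (h (s - t + ε) - h (s - t)) / 2 := by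
    simp only [hh, incCov]
    rw [show s + ε - t = s - t + ε by ring, show s - (t + δ) = s - t - δ by ring,
      show s + ε - (t + δ) = s - t + ε - δ by ring]
    ring
  rw [hinc, abs_div, abs_of_pos (by norm_num : (0 : ℝ) < 2), div_le_iff₀ (by norm_num)]
  refine hfin.trans (le_of_sub_nonneg ?_)
  have : 0 ≤ ε * δ * |t - s| ^ (2 * H - 2) / γ := by positivity
  have e : 8 / γ * ε * δ * |t - s| ^ (2 * H - 2) * 2 -
      4 * δ / γ * (2 * ε * |t - s| ^ (2 * H - 2)) = 8 * (ε * δ * |t - s| ^ (2 * H - 2) / γ) := by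
    ring
  rw [e]; positivity

/-- Two mean value theorems, one for each increment; the separation hypothesis keeps all
intermediate points away from 0, where the second derivative of `|x| ^ (2H)` blows up. -/
lemma exists_incCov_eq_abs_rpow {H : ℝ} (hH : 1 / 2 < H) {s t ε δ : ℝ}
    (hε : 0 < ε) (hδ : 0 < δ) (hsep : ε + δ < |s - t|) :
    ∃ z, |z - (s - t)| ≤ ε + δ ∧
      incCov H s (s + ε) t (t + δ) / (ε * δ) = H * (2 * H - 1) * |z| ^ (2 * H - 2) := by
  set γ := 2 * H - 1 with hγdef
  have hγ : 0 < γ := by linarith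
  set r := s - t with hr
  set h : ℝ → ℝ := fun x => |x| ^ (2 * H) - |x - δ| ^ (2 * H) with hh
  have hderiv : ∀ x, HasDerivAt h (2 * H * (oddPow γ x - oddPow γ (x - δ))) x := fun x => by
    simpa [hh] using hasDerivAt_abs_sub_rpow_sub hH 0 δ x
  have hcont : Continuous h := continuous_iff_continuousAt.2 fun x => (hderiv x).continuousAt
  obtain ⟨ξ, hξ, hξ'⟩ := exists_hasDerivAt_eq_slope h _ (by linarith : r < r + ε)
    hcont.continuousOn fun x _ => hderiv x
  have hne : ∀ x, |x - r| ≤ ε + δ → x ≠ 0 := by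
    rintro x hx rfl
    rw [zero_sub, abs_neg] at hx; linarith
  have hder2 : ∀ x ∈ Set.Icc (ξ - δ) ξ, HasDerivAt (oddPow γ) (γ * |x| ^ (γ - 1)) x := fun x hx =>
    hasDerivAt_oddPow hγ (hne x (abs_le.2 ⟨by linarith [hx.1, hξ.1], by linarith [hx.2, hξ.2]⟩))
  obtain ⟨z, hz, hz'⟩ := exists_hasDerivAt_eq_slope (oddPow γ) _ (by linarith : ξ - δ < ξ)
    (fun x hx => (hder2 x hx).continuousAt.continuousWithinAt)
    fun x hx => hder2 x (Set.Ioo_subset_Icc_self hx)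
  refine ⟨z, abs_le.2 ⟨by linarith [hz.1, hξ.1], by linarith [hz.2, hξ.2]⟩, ?_⟩
  have hinc : incCov H s (s + ε) t (t + δ) = (h (r + ε) - h r) / 2 := by
    simp only [hh, incCov]
    rw [show s + ε - t = r + ε by rw [hr]; ring, show s - (t + δ) = r - δ by rw [hr]; ring,
      show s + ε - (t + δ) = r + ε - δ by rw [hr]; ring]
    ring
  rw [add_sub_cancel_left] at hξ'
  rw [sub_sub_cancel] at hz'
  rw [eq_div_iff hε.ne'] at hξ'
  rw [eq_div_iff hδ.ne'] at hz'
  rw [hinc, ← hξ', ← hz', show 2 * H - 2 = γ - 1 by rw [hγdef]; ring]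
  field_simp

/-- The limit is joint in the two step sizes, as required by the Cauchy argument in L². -/
lemma tendsto_incCov_div_mul {H : ℝ} (hH : 1 / 2 < H) {s t : ℝ} (hst : s ≠ t) :
    Tendsto (fun p : ℝ × ℝ => incCov H s (s + p.1) t (t + p.2) / (p.1 * p.2))
      (𝓝[>] 0 ×ˢ 𝓝[>] 0) (𝓝 (H * (2 * H - 1) * |s - t| ^ (2 * H - 2))) := by
  have hr : 0 < |s - t| := abs_pos.2 (sub_ne_zero.2 hst)
  have hev : ∀ η > 0, ∀ᶠ p : ℝ × ℝ in 𝓝[>] 0 ×ˢ 𝓝[>] 0, 0 < p.1 ∧ 0 < p.2 ∧ p.1 + p.2 < η := by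
    intro η hη
    have h1 : ∀ᶠ x : ℝ in 𝓝[>] 0, 0 < x ∧ x < η / 2 :=
      Ioo_mem_nhdsGT (by positivity)
    filter_upwards [h1.prod_mk h1] with p hp
    exact ⟨hp.1.1, hp.2.1, by linarith [hp.1.2, hp.2.2]⟩
  have hc : ContinuousAt (fun z : ℝ => H * (2 * H - 1) * |z| ^ (2 * H - 2)) (s - t) :=
    (ContinuousAt.rpow_const (by fun_prop) (Or.inl hr.ne')).const_mul _
  rw [Metric.continuousAt_iff] at hc
  rw [Metric.tendsto_nhds]
  intro η hη
  obtain ⟨ρ, hρ, hρ'⟩ := hc η hη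
  filter_upwards [hev _ (lt_min hr hρ)] with p hp
  obtain ⟨z, hz, hz'⟩ := exists_incCov_eq_abs_rpow hH hp.1 hp.2.1
    (hp.2.2.trans_le (min_le_left _ _))
  rw [hz']
  refine hρ' ?_
  rw [Real.dist_eq]
  exact hz.trans_lt (hp.2.2.trans_le (min_le_right _ _))

/-- Interpolation of `x + y` between the `ℓ¹` and `ℓ²` norms of `(x^H, y^H)`. -/
lemma add_rpow_two_mul_le {H x y : ℝ} (hH : 1 / 2 < H) (hH' : H < 1) (hx : 0 < x) (hy : 0 < y) :
    (x + y) ^ (2 * H) ≤ x ^ (2 * H) + y ^ (2 * H) + 2 * (2 * H - 1) * (x ^ H * y ^ H) := by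
  have hH0 : 0 < H := by linarith
  -- The weights satisfy `α + β = 1` and `Hα + 2Hβ = 1`, so that `z = (z^H)^α (z^(2H))^β`. Young's
  -- inequality, normalised by `S` and `Q`, then gives Hölder's inequality for the two-term sum.
  set α := 2 - 1 / H with hα
  set β := 1 / H - 1 with hβ
  have hα0 : 0 ≤ α := by
    rw [hα, sub_nonneg, div_le_iff₀ hH0]; linarith
  have hβ0 : 0 ≤ β := by
    rw [hβ, sub_nonneg, le_div_iff₀ hH0]; linarith
  have hxH := Real.rpow_pos_of_pos hx H
  have hyH := Real.rpow_pos_of_pos hy H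
  have hx2 : x ^ (2 * H) = x ^ H * x ^ H := by rw [← Real.rpow_add hx]; ring_nf
  have hy2 : y ^ (2 * H) = y ^ H * y ^ H := by rw [← Real.rpow_add hy]; ring_nf
  set S := x ^ H + y ^ H with hS
  set Q := x ^ (2 * H) + y ^ (2 * H) with hQ
  have hS0 : 0 < S := by positivity
  have hQ0 : 0 < Q := by positivity
  have hone : ∀ z : ℝ, 0 < z → (z ^ H / S) ^ α * (z ^ (2 * H) / Q) ^ β = z / (S ^ α * Q ^ β) := by
    intro z hz
    rw [Real.div_rpow (by positivity) hS0.le, Real.div_rpow (by positivity) hQ0.le,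
      ← Real.rpow_mul hz.le, ← Real.rpow_mul hz.le, div_mul_div_comm, ← Real.rpow_add hz]
    congr 1
    have : H * α + 2 * H * β = 1 := by rw [hα, hβ]; field_simp; ring
    rw [this, Real.rpow_one]
  have hyoung : ∀ z : ℝ, 0 < z → z / (S ^ α * Q ^ β) ≤ α * (z ^ H / S) + β * (z ^ (2 * H) / Q) :=
    fun z hz => by
      rw [← hone z hz]
      exact Real.geom_mean_le_arith_mean2_weighted hα0 hβ0 (by positivity) (by positivity)
        (by rw [hα, hβ]; ring)
  have hsum : x + y ≤ S ^ α * Q ^ β := by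
    have h1 := add_le_add (hyoung x hx) (hyoung y hy)
    have h2 : α * (x ^ H / S) + β * (x ^ (2 * H) / Q) + (α * (y ^ H / S) + β * (y ^ (2 * H) / Q))
        = 1 := by
      have : α * (S / S) + β * (Q / Q) = 1 := by
        rw [div_self hS0.ne', div_self hQ0.ne', hα, hβ]; ring
      rw [← this, hS, hQ]; ring
    rw [h2, ← add_div, div_le_one (by positivity)] at h1
    exact h1
  -- After raising to the power `2H`, a second weighted AM-GM has weights `2H - 1` and `2 - 2H`;
  -- since `S² = Q + 2 x^H y^H`, exactly `2(2H - 1) x^H y^H` remains beside `Q`.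
  calc (x + y) ^ (2 * H) ≤ (S ^ α * Q ^ β) ^ (2 * H) :=
        Real.rpow_le_rpow (by positivity) hsum (by linarith)
    _ = (S ^ (2 : ℝ)) ^ (2 * H - 1) * Q ^ (2 - 2 * H) := by
        rw [Real.mul_rpow (by positivity) (by positivity), ← Real.rpow_mul hS0.le,
          ← Real.rpow_mul hQ0.le, ← Real.rpow_mul hS0.le]
        congr 2
        · rw [hα]; field_simp
        · rw [hβ]; field_simp;
    _ ≤ (2 * H - 1) * S ^ (2 : ℝ) + (2 - 2 * H) * Q :=
        Real.geom_mean_le_arith_mean2_weighted (by linarith) (by linarith) (by positivity)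
          (by positivity) (by ring)
    _ = _ := by
        rw [Real.rpow_two, hS, hQ, hx2, hy2]; ring

/-- The covariance is nonnegative because `x ↦ x^(2H)` is superadditive; the upper bound is
`add_rpow_two_mul_le`. The factor `2H - 1 < 1` is a strict, scale-free improvement on
Cauchy–Schwarz. -/
lemma abs_incCov_zero_le {H m M : ℝ} (hH : 1 / 2 < H) (hH' : H < 1) (hm : 0 < m) (hM : m < M) :
    |incCov H 0 m m M| ≤ (2 * H - 1) * (m ^ H * (M - m) ^ H) := by
  have hd : 0 < M - m := by linarith
  have h1 := add_rpow_two_mul_le hH hH' hm hd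
  have h2 := Real.add_rpow_le_rpow_add hm.le hd.le (by linarith : 1 ≤ 2 * H)
  rw [add_sub_cancel] at h1 h2
  have e : incCov H 0 m m M = (M ^ (2 * H) - m ^ (2 * H) - (M - m) ^ (2 * H)) / 2 := by
    rw [incCov, sub_self, abs_zero, Real.zero_rpow (by linarith), zero_sub, zero_sub, abs_neg,
      abs_neg, abs_of_pos hm, abs_of_pos (hm.trans hM), abs_sub_comm, abs_of_pos hd]
    ring
  rw [e, abs_of_nonneg (by linarith)]
  linarith

/-! ### Regression with independent residuals. -/

section Regression

variable {Ω : Type*} [MeasurableSpace Ω] {P : Measure Ω}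

lemma integrable_mul_mul_of_sq {Φ x y : Ω → ℝ} (hΦ : AEStronglyMeasurable Φ P)
    (hx : AEStronglyMeasurable x P) (hy : AEStronglyMeasurable y P)
    (hxx : Integrable (fun ω => Φ ω * x ω ^ 2) P) (hyy : Integrable (fun ω => Φ ω * y ω ^ 2) P) :
    Integrable (fun ω => Φ ω * (x ω * y ω)) P := by
  refine Integrable.mono' (hxx.abs.add hyy.abs) (hΦ.mul (hx.mul hy)) (ae_of_all _ fun ω => ?_)
  simp only [Pi.add_apply, Real.norm_eq_abs, abs_mul, abs_pow]
  rw [← mul_add]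
  refine mul_le_mul_of_nonneg_left ?_ (abs_nonneg _)
  nlinarith [sq_nonneg (|x ω| - |y ω|), sq_nonneg (|x ω| + |y ω|)]

lemma integrable_mul_of_sq {Φ x : Ω → ℝ} (hΦ : Integrable Φ P)
    (hx : AEStronglyMeasurable x P) (hxx : Integrable (fun ω => Φ ω * x ω ^ 2) P) :
    Integrable (fun ω => Φ ω * x ω) P := by
  have := integrable_mul_mul_of_sq hΦ.1 hx (aestronglyMeasurable_const (b := (1 : ℝ))) hxx
    (by simpa using hΦ)
  simpa using this

/-- Product of two regressions on `G` with residuals independent of `G`, weighted by a function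
of `G`. -/
lemma integral_mul_add_mul_add_of_indepFun {𝓖 : Type*} [MeasurableSpace 𝓖] {G : Ω → 𝓖}
    {X Z : Ω → ℝ} [IsFiniteMeasure P]
    (hind : IndepFun G (fun ω => (X ω, Z ω)) P) {φ α γ : 𝓖 → ℝ}
    (hφ : Measurable φ) (hα : Measurable α) (hγ : Measurable γ)
    (hX : MemLp X 2 P) (hZ : MemLp Z 2 P) (hX0 : ∫ ω, X ω ∂P = 0) (hZ0 : ∫ ω, Z ω ∂P = 0)
    (h1 : Integrable (fun ω => φ (G ω)) P) (h2 : Integrable (fun ω => φ (G ω) * α (G ω)) P)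
    (h3 : Integrable (fun ω => φ (G ω) * γ (G ω)) P)
    (h4 : Integrable (fun ω => φ (G ω) * (α (G ω) * γ (G ω))) P) :
    ∫ ω, φ (G ω) * ((α (G ω) + X ω) * (γ (G ω) + Z ω)) ∂P =
      ∫ ω, φ (G ω) * (α (G ω) * γ (G ω)) ∂P + (∫ ω, φ (G ω) ∂P) * ∫ ω, X ω * Z ω ∂P := by
  have i1 : IndepFun (fun ω => φ (G ω) * α (G ω)) Z P :=
    hind.comp (hφ.mul hα) measurable_snd
  have i2 : IndepFun (fun ω => φ (G ω) * γ (G ω)) X P :=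
    hind.comp (hφ.mul hγ) measurable_fst
  have i3 : IndepFun (fun ω => φ (G ω)) (fun ω => X ω * Z ω) P :=
    hind.comp hφ (measurable_fst.mul measurable_snd)
  have hXi := hX.integrable one_le_two
  have hZi := hZ.integrable one_le_two
  have hXZ : Integrable (fun ω => X ω * Z ω) P := hX.integrable_mul hZ
  have j1 : Integrable (fun ω => φ (G ω) * α (G ω) * Z ω) P := i1.integrable_mul h2 hZi
  have j2 : Integrable (fun ω => φ (G ω) * γ (G ω) * X ω) P := i2.integrable_mul h3 hXi
  have j3 : Integrable (fun ω => φ (G ω) * (X ω * Z ω)) P := i3.integrable_mul h1 hXZ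
  have e1 := i1.integral_fun_mul_eq_mul_integral h2.1 hZi.1
  have e2 := i2.integral_fun_mul_eq_mul_integral h3.1 hXi.1
  have e3 := i3.integral_fun_mul_eq_mul_integral h1.1 hXZ.1
  rw [hZ0, mul_zero] at e1
  rw [hX0, mul_zero] at e2
  have hexp : (fun ω => φ (G ω) * ((α (G ω) + X ω) * (γ (G ω) + Z ω))) =
      fun ω => (φ (G ω) * (α (G ω) * γ (G ω)) + φ (G ω) * α (G ω) * Z ω) +
        (φ (G ω) * γ (G ω) * X ω + φ (G ω) * (X ω * Z ω)) := by
    ext ω; ring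
  have k1 : Integrable (fun ω => φ (G ω) * (α (G ω) * γ (G ω)) + φ (G ω) * α (G ω) * Z ω) P :=
    h4.add j1
  have k2 : Integrable (fun ω => φ (G ω) * γ (G ω) * X ω + φ (G ω) * (X ω * Z ω)) P := j2.add j3
  rw [hexp, integral_add k1 k2, integral_add h4 j1, integral_add j2 j3,
    e1, e2, e3]
  ring

end Regression

/-- First coordinate of the solution `(a, b)` of `a + r b = v`, `r a + b = w`. -/
noncomputable def regCoeff (r v w : ℝ) : ℝ := (v - r * w) / (1 - r ^ 2)

lemma regCoeff_add {r : ℝ} (hr : |r| < 1) (v w : ℝ) :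
    regCoeff r v w + r * regCoeff r w v = v := by
  have : 1 - r ^ 2 ≠ 0 := by
    have := (sq_lt_one_iff_abs_lt_one r).2 hr; linarith
  rw [regCoeff, regCoeff]; field_simp; ring

/-- A correlation bounded away from 1 keeps the determinant `1 - r²` bounded below. -/
lemma abs_regCoeff_le {r κ v w A : ℝ} (hκ : κ < 1) (hr : |r| ≤ κ) (hv : |v| ≤ A) (hw : |w| ≤ A) :
    |regCoeff r v w| ≤ 2 / (1 - κ ^ 2) * A := by
  have hκ0 : 0 ≤ κ := (abs_nonneg r).trans hr
  have h1 : r ^ 2 ≤ κ ^ 2 := by rw [← sq_abs r]; exact pow_le_pow_left₀ (abs_nonneg r) hr 2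
  have h2 : 0 < 1 - κ ^ 2 := by nlinarith
  have h3 : 0 < 1 - r ^ 2 := by linarith
  have hA : 0 ≤ A := (abs_nonneg _).trans hv
  rw [regCoeff, abs_div, abs_of_pos h3, div_mul_eq_mul_div]
  refine div_le_div₀ (by positivity) ?_ h2 (by linarith)
  have h4 : |v - r * w| ≤ |v| + |r| * |w| := by rw [← abs_mul]; exact abs_sub _ _
  have h5 : |r| * |w| ≤ 1 * A := mul_le_mul (by linarith) hw (abs_nonneg _) zero_le_one
  linarith

/-! ### Normalised regressors and their covariances. -/

section FractionalBrownian

variable {Ω : Type*} [MeasurableSpace Ω] {P : Measure Ω} {H : ℝ} {d : ℕ}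
  {B : ℝ≥0 → Ω → EuclideanSpace ℝ (Fin d)}

lemma IsFBM.memLp_eval (hB : IsFBM P H d B) (t : ℝ≥0) (i : Fin d) {p : ℝ≥0∞} (hp : p ≠ ∞) :
    MemLp (fun ω => B t ω i) p P :=
  ((hB.isGaussianProcess.hasGaussianLaw_eval t).map_fun
    (EuclideanSpace.proj (𝕜 := ℝ) i)).memLp hp

lemma IsFBM.isProbabilityMeasure (hB : IsFBM P H d B) : IsProbabilityMeasure P :=
  hB.isGaussianProcess.isProbabilityMeasure

lemma IsFBM.covariance_eval (hB : IsFBM P H d B) (s t : ℝ≥0) (i j : Fin d) :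
    cov[fun ω => B s ω i, fun ω => B t ω j; P] = if i = j then fbmCov H s t else 0 := by
  have := hB.isProbabilityMeasure
  rw [covariance_eq_sub (hB.memLp_eval s i (by simp)) (hB.memLp_eval t j (by simp)),
    hB.centered, zero_mul, sub_zero]
  exact hB.covariance s t i j

lemma IsFBM.covariance_sub_sub (hB : IsFBM P H d B) (a b c e : ℝ≥0) (i j : Fin d) :
    cov[fun ω => B b ω i - B a ω i, fun ω => B e ω j - B c ω j; P] =
      if i = j then incCov H a b c e else 0 := by
  have := hB.isProbabilityMeasure
  have hm := fun t k => hB.memLp_eval t k (p := 2) (by simp)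
  rw [covariance_fun_sub_fun_sub (hm _ _) (hm _ _) (hm _ _) (hm _ _)]
  simp only [hB.covariance_eval]
  split_ifs
  · simp only [fbmCov, incCov, abs_sub_comm (e : ℝ), abs_sub_comm (c : ℝ)]; ring
  · ring

lemma IsFBM.covariance_eval_sub (hB : IsFBM P H d B) (m c e : ℝ≥0) (i j : Fin d) :
    cov[fun ω => B m ω i, fun ω => B e ω j - B c ω j; P] =
      if i = j then incCov H 0 m c e else 0 := by
  have := hB.isProbabilityMeasure
  have hm := fun t k => hB.memLp_eval t k (p := 2) (by simp)
  rw [covariance_fun_sub_right (hm _ _) (hm _ _) (hm _ _)]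
  simp only [hB.covariance_eval]
  split_ifs
  · simp only [fbmCov, incCov, abs_sub_comm (e : ℝ), abs_sub_comm (c : ℝ), zero_sub, abs_neg,
      NNReal.abs_eq]; ring
  · ring

/-- The first normalised regressor `B_m / m^H`. -/
noncomputable def stdFst (H : ℝ) (B : ℝ≥0 → Ω → EuclideanSpace ℝ (Fin d)) (m : ℝ≥0) (i : Fin d)
    (ω : Ω) : ℝ := ((m : ℝ) ^ H)⁻¹ * B m ω i

/-- The second normalised regressor `(B_M - B_m) / (M - m)^H`. -/
noncomputable def stdSnd (H : ℝ) (B : ℝ≥0 → Ω → EuclideanSpace ℝ (Fin d)) (m M : ℝ≥0) (i : Fin d)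
    (ω : Ω) : ℝ := (((M : ℝ) - m) ^ H)⁻¹ * (B M ω i - B m ω i)

/-- The correlation of the normalised regressors. -/
noncomputable def stdCorr (H : ℝ) (m M : ℝ≥0) : ℝ :=
  ((m : ℝ) ^ H)⁻¹ * ((((M : ℝ) - m) ^ H)⁻¹ * incCov H 0 m m M)

/-- Covariance of the increment `B_{s'} - B_s` with the first normalised regressor. -/
noncomputable def covFst (H : ℝ) (m : ℝ≥0) (s s' : ℝ) : ℝ := ((m : ℝ) ^ H)⁻¹ * incCov H s s' 0 m

/-- Covariance of the increment `B_{s'} - B_s` with the second normalised regressor. -/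
noncomputable def covSnd (H : ℝ) (m M : ℝ≥0) (s s' : ℝ) : ℝ :=
  (((M : ℝ) - m) ^ H)⁻¹ * incCov H s s' m M

lemma abs_stdCorr_le (hH : 1 / 2 < H) (hH' : H < 1) {m M : ℝ≥0} (hm : 0 < m) (hM : m < M) :
    |stdCorr H m M| ≤ 2 * H - 1 := by
  have hm' : (0 : ℝ) < m := hm
  have hM' : (m : ℝ) < M := hM
  have hd : (0 : ℝ) < M - m := sub_pos.2 hM'
  have h1 := Real.rpow_pos_of_pos hm' H
  have h2 := Real.rpow_pos_of_pos hd H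
  have := abs_incCov_zero_le hH hH' hm' hM'
  rw [stdCorr, ← mul_assoc, ← mul_inv, abs_mul, abs_of_pos (by positivity), inv_mul_le_iff₀
    (by positivity)]
  linarith

lemma incCov_self_of_le {H m M : ℝ} (hH : 0 < H) (h : m ≤ M) :
    incCov H m M m M = (M - m) ^ (2 * H) := by
  rw [incCov, sub_self, sub_self, abs_zero, Real.zero_rpow (by linarith), abs_sub_comm,
    abs_of_nonpos (by linarith), neg_sub]; ring

lemma rpow_two_mul_inv {x : ℝ} (hx : 0 < x) (H : ℝ) : (x ^ H)⁻¹ * ((x ^ H)⁻¹ * x ^ (2 * H)) = 1 := by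
  have := Real.rpow_pos_of_pos hx H
  rw [two_mul, Real.rpow_add hx]; field_simp

lemma IsFBM.covariance_stdFst_sub (hB : IsFBM P H d B) (m s s' : ℝ≥0) (i j : Fin d) :
    cov[stdFst H B m i, fun ω => B s' ω j - B s ω j; P] =
      if i = j then covFst H m s s' else 0 := by
  unfold stdFst
  rw [covariance_const_mul_left, hB.covariance_eval_sub, ← incCov_comm]
  split_ifs <;> simp [covFst]

lemma IsFBM.covariance_stdSnd_sub (hB : IsFBM P H d B) (m M s s' : ℝ≥0) (i j : Fin d) :
    cov[stdSnd H B m M i, fun ω => B s' ω j - B s ω j; P] =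
      if i = j then covSnd H m M s s' else 0 := by
  unfold stdSnd
  rw [covariance_const_mul_left, hB.covariance_sub_sub, ← incCov_comm]
  split_ifs <;> simp [covSnd]

lemma IsFBM.covariance_stdFst_stdFst (hH : 0 < H) (hB : IsFBM P H d B) {m : ℝ≥0} (hm : 0 < m)
    (i j : Fin d) :
    cov[stdFst H B m i, stdFst H B m j; P] = if i = j then 1 else 0 := by
  unfold stdFst
  rw [covariance_const_mul_left, covariance_const_mul_right, hB.covariance_eval]
  split_ifs
  · rw [fbmCov, sub_self, abs_zero, Real.zero_rpow (by linarith), sub_zero, add_self_div_two]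
    exact rpow_two_mul_inv hm H
  · simp

lemma IsFBM.covariance_stdSnd_stdSnd (hH : 0 < H) (hB : IsFBM P H d B) {m M : ℝ≥0} (hM : m < M)
    (i j : Fin d) :
    cov[stdSnd H B m M i, stdSnd H B m M j; P] = if i = j then 1 else 0 := by
  have hM' : (m : ℝ) < M := hM
  unfold stdSnd
  rw [covariance_const_mul_left, covariance_const_mul_right, hB.covariance_sub_sub]
  split_ifs
  · rw [incCov_self_of_le hH hM'.le]
    exact rpow_two_mul_inv (sub_pos.2 hM') H
  · simp

lemma IsFBM.covariance_stdFst_stdSnd (hB : IsFBM P H d B) (m M : ℝ≥0)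
    (i j : Fin d) :
    cov[stdFst H B m i, stdSnd H B m M j; P] = if i = j then stdCorr H m M else 0 := by
  unfold stdFst stdSnd
  rw [covariance_const_mul_left, covariance_const_mul_right, hB.covariance_eval_sub]
  split_ifs <;> simp [stdCorr]

lemma IsFBM.memLp_stdFst (hB : IsFBM P H d B) (m : ℝ≥0) (i : Fin d) {p : ℝ≥0∞} (hp : p ≠ ∞) :
    MemLp (stdFst H B m i) p P := (hB.memLp_eval m i hp).const_mul _

lemma IsFBM.memLp_stdSnd (hB : IsFBM P H d B) (m M : ℝ≥0) (i : Fin d) {p : ℝ≥0∞} (hp : p ≠ ∞) :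
    MemLp (stdSnd H B m M i) p P := ((hB.memLp_eval M i hp).sub (hB.memLp_eval m i hp)).const_mul _

lemma IsFBM.integral_sub (hB : IsFBM P H d B) (s s' : ℝ≥0) (i : Fin d) :
    ∫ ω, (B s' ω i - B s ω i) ∂P = 0 := by
  have := hB.isProbabilityMeasure
  have hm := fun t k => (hB.memLp_eval t k (p := 2) (by simp)).integrable one_le_two
  rw [MeasureTheory.integral_sub (hm _ _) (hm _ _), hB.centered, hB.centered, sub_zero]

lemma IsFBM.integral_stdFst (hB : IsFBM P H d B) (m : ℝ≥0) (i : Fin d) :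
    ∫ ω, stdFst H B m i ω ∂P = 0 := by
  unfold stdFst; rw [integral_const_mul, hB.centered, mul_zero]

lemma IsFBM.integral_stdSnd (hB : IsFBM P H d B) (m M : ℝ≥0) (i : Fin d) :
    ∫ ω, stdSnd H B m M i ω ∂P = 0 := by
  unfold stdSnd; rw [integral_const_mul, hB.integral_sub, mul_zero]

/-- The index map may repeat times. This matters because the regressor times will be two of the
increment times. -/
lemma ProbabilityTheory.IsGaussianProcess.hasGaussianLaw_comp {τ ι E : Type*} [Finite ι]
    [NormedAddCommGroup E] [MeasurableSpace E] [BorelSpace E] [NormedSpace ℝ E]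
    [SecondCountableTopology E] {X : τ → Ω → E} (hX : IsGaussianProcess X P) (f : ι → τ) :
    HasGaussianLaw (fun ω k => X (f k) ω) P := by
  have := Fintype.ofFinite ι
  exact ((hX.comp_right f).hasGaussianLaw Finset.univ).map
    (ContinuousLinearMap.pi fun k => ContinuousLinearMap.proj (R := ℝ)
      (φ := fun _ : (Finset.univ : Finset ι) => E) ⟨k, Finset.mem_univ k⟩)

end FractionalBrownian

/-! ### The Gaussian regression formula. -/

section FractionalBrownian

variable {Ω : Type*} [MeasurableSpace Ω] {P : Measure Ω} {H : ℝ} {d : ℕ}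
  {B : ℝ≥0 → Ω → EuclideanSpace ℝ (Fin d)}

/-- The regressors and the residuals of two increments are independent. -/
lemma IsFBM.indepFun_residuals (hH : 1 / 2 < H) (hH' : H < 1) (hB : IsFBM P H d B) {m M : ℝ≥0}
    (hm : 0 < m) (hM : m < M) (s s' t t' : ℝ≥0) (i j : Fin d) {a b a' b' : ℝ}
    (h1 : a + stdCorr H m M * b = covFst H m s s') (h2 : b + stdCorr H m M * a = covSnd H m M s s')
    (h1' : a' + stdCorr H m M * b' = covFst H m t t')
    (h2' : b' + stdCorr H m M * a' = covSnd H m M t t') :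
    IndepFun (fun ω (k : Fin 2 × Fin d) =>
        if k.1 = 0 then stdFst H B m k.2 ω else stdSnd H B m M k.2 ω)
      (fun ω => ((B s' ω i - B s ω i) - (a * stdFst H B m i ω + b * stdSnd H B m M i ω),
        (B t' ω j - B t ω j) - (a' * stdFst H B m j ω + b' * stdSnd H B m M j ω))) P := by
  have := hB.isProbabilityMeasure
  have hH0 : 0 < H := by linarith
  have hgauss := hB.isGaussianProcess.hasGaussianLaw_comp ![m, M, s, s', t, t']
  let u : (Fin 6 → EuclideanSpace ℝ (Fin d)) → Fin d → ℝ := fun x k => ((m : ℝ) ^ H)⁻¹ * x 0 k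
  let v : (Fin 6 → EuclideanSpace ℝ (Fin d)) → Fin d → ℝ := fun x k => (((M : ℝ) - m) ^ H)⁻¹ * (x 1 k - x 0 k)
  -- Regressors and residuals together are one linear image of the Gaussian vector at the six times;
  -- hence they are jointly Gaussian and zero cross-covariance implies independence.
  let L : (Fin 6 → EuclideanSpace ℝ (Fin d)) →L[ℝ] (Fin 2 × Fin d → ℝ) × (Fin 2 → ℝ) :=
    { toFun x := (fun k => if k.1 = 0 then u x k.2 else v x k.2,
        fun l => if l = 0 then (x 3 i - x 2 i) - (a * u x i + b * v x i)
          else (x 5 j - x 4 j) - (a' * u x j + b' * v x j))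
      map_add' x y := by
        ext k
        · dsimp only [u, v]; split_ifs <;> simp [*] <;> ring
        · dsimp only [u, v]; split_ifs <;> simp [*] <;> ring
      map_smul' c x := by
        ext k
        · dsimp only [u, v]; split_ifs <;> simp [*] <;> ring
        · dsimp only [u, v]; split_ifs <;> simp [*] <;> ring
      cont := by
        refine Continuous.prodMk (continuous_pi fun k => ?_) (continuous_pi fun k => ?_)
        · dsimp only [u, v]; split_ifs <;> fun_prop
        · dsimp only [u, v]; split_ifs <;> fun_prop }
  have hL := hgauss.map L
  have hind := HasGaussianLaw.indepFun_of_covariance_eval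
    (X := fun (k : Fin 2 × Fin d) ω =>
        if k.1 = 0 then stdFst H B m k.2 ω else stdSnd H B m M k.2 ω)
    (Y := fun (l : Fin 2) ω =>
      if l = 0 then (B s' ω i - B s ω i) - (a * stdFst H B m i ω + b * stdSnd H B m M i ω)
        else (B t' ω j - B t ω j) - (a' * stdFst H B m j ω + b' * stdSnd H B m M j ω)) hL ?_
  · exact hind.comp (ψ := fun y : Fin 2 → ℝ => (y 0, y 1)) measurable_id (by fun_prop)
  · have hU := fun k => hB.memLp_stdFst m k (p := 2) (by simp)
    have hV := fun k => hB.memLp_stdSnd m M k (p := 2) (by simp)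
    have hX : ∀ (r r' : ℝ≥0) k, MemLp (fun ω => B r' ω k - B r ω k) 2 P := fun r r' k =>
      (hB.memLp_eval r' k (by simp)).sub (hB.memLp_eval r k (by simp))
    have hY : ∀ (c e : ℝ) k, MemLp (fun ω => c * stdFst H B m k ω + e * stdSnd H B m M k ω) 2 P :=
      fun c e k => ((hU k).const_mul c).add ((hV k).const_mul e)
    -- The normal equations say precisely that a residual is orthogonal to both regressors in its
    -- own coordinate; distinct coordinates are uncorrelated anyway.
    have key : ∀ (r r' : ℝ≥0) (c e : ℝ) (k l : Fin d),
        c + stdCorr H m M * e = covFst H m r r' → e + stdCorr H m M * c = covSnd H m M r r' →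
        cov[stdFst H B m k, fun ω => (B r' ω l - B r ω l) -
          (c * stdFst H B m l ω + e * stdSnd H B m M l ω); P] = 0 ∧
        cov[stdSnd H B m M k, fun ω => (B r' ω l - B r ω l) -
          (c * stdFst H B m l ω + e * stdSnd H B m M l ω); P] = 0 := by
      intro r r' c e k l e1 e2
      constructor
      · rw [covariance_fun_sub_right (hU k) (hX r r' l) (hY c e l),
          show (fun ω => c * stdFst H B m l ω + e * stdSnd H B m M l ω) =
            (fun ω => c * stdFst H B m l ω) + fun ω => e * stdSnd H B m M l ω from rfl,
          covariance_add_right (hU k) ((hU l).const_mul c) ((hV l).const_mul e),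
          covariance_const_mul_right, covariance_const_mul_right, hB.covariance_stdFst_sub,
          hB.covariance_stdFst_stdFst hH0 hm, hB.covariance_stdFst_stdSnd]
        split_ifs
        · linarith
        · ring
      · rw [covariance_fun_sub_right (hV k) (hX r r' l) (hY c e l),
          show (fun ω => c * stdFst H B m l ω + e * stdSnd H B m M l ω) =
            (fun ω => c * stdFst H B m l ω) + fun ω => e * stdSnd H B m M l ω from rfl,
          covariance_add_right (hV k) ((hU l).const_mul c) ((hV l).const_mul e),
          covariance_const_mul_right, covariance_const_mul_right, hB.covariance_stdSnd_sub,
          hB.covariance_stdSnd_stdSnd hH0 hM, covariance_comm, hB.covariance_stdFst_stdSnd]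
        simp only [eq_comm (a := l)]
        split_ifs
        · linarith
        · ring
    intro k l
    have k1 := key s s' a b k.2 i h1 h2
    have k2 := key t t' a' b' k.2 j h1' h2'
    by_cases hk : k.1 = 0 <;> by_cases hl : l = 0 <;> simp only [hk, hl, if_true, if_false]
    · exact k1.1
    · exact k2.1
    · exact k1.2
    · exact k2.2

/-- The correction term in the regression formula for products of increments. -/
noncomputable def resCov (H r a b a' b' : ℝ) (s s' t t' : ℝ) : ℝ :=
  incCov H s s' t t' - (a * a' + (a * b' + b * a') * r + b * b')

/-- Gaussian regression formula: the expectation of a product of two increments, weighted by a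
function `Φ` of `(B_m, B_M)`. -/
theorem IsFBM.integral_mul_increment_mul_increment (hH : 1 / 2 < H) (hH' : H < 1)
    (hB : IsFBM P H d B) {m M : ℝ≥0} (hm : 0 < m) (hM : m < M) (s s' t t' : ℝ≥0) (i j : Fin d)
    {a b a' b' : ℝ}
    (h1 : a + stdCorr H m M * b = covFst H m s s') (h2 : b + stdCorr H m M * a = covSnd H m M s s')
    (h1' : a' + stdCorr H m M * b' = covFst H m t t')
    (h2' : b' + stdCorr H m M * a' = covSnd H m M t t')
    {φ : EuclideanSpace ℝ (Fin d) × EuclideanSpace ℝ (Fin d) → ℝ} (hφ : Measurable φ)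
    {Φ : Ω → ℝ} (hΦ : Φ = fun ω => φ (B m ω, B M ω)) (hi : Integrable Φ P)
    (hU : ∀ k, Integrable (fun ω => Φ ω * stdFst H B m k ω ^ 2) P)
    (hV : ∀ k, Integrable (fun ω => Φ ω * stdSnd H B m M k ω ^ 2) P) :
    ∫ ω, Φ ω * ((B s' ω i - B s ω i) * (B t' ω j - B t ω j)) ∂P =
      (a * a' * ∫ ω, Φ ω * (stdFst H B m i ω * stdFst H B m j ω) ∂P +
        a * b' * ∫ ω, Φ ω * (stdFst H B m i ω * stdSnd H B m M j ω) ∂P +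
        b * a' * ∫ ω, Φ ω * (stdSnd H B m M i ω * stdFst H B m j ω) ∂P +
        b * b' * ∫ ω, Φ ω * (stdSnd H B m M i ω * stdSnd H B m M j ω) ∂P) +
      (∫ ω, Φ ω ∂P) * if i = j then resCov H (stdCorr H m M) a b a' b' s s' t t' else 0 := by
  have := hB.isProbabilityMeasure
  have hH0 : 0 < H := by linarith
  have hind := hB.indepFun_residuals hH hH' hm hM s s' t t' i j h1 h2 h1' h2'
  set G : Ω → Fin 2 × Fin d → ℝ := fun ω k =>
    if k.1 = 0 then stdFst H B m k.2 ω else stdSnd H B m M k.2 ω with hG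
  have hmH : (m : ℝ) ^ H ≠ 0 := (Real.rpow_pos_of_pos (by exact_mod_cast hm) H).ne'
  have hMH : ((M : ℝ) - m) ^ H ≠ 0 :=
    (Real.rpow_pos_of_pos (sub_pos.2 (by exact_mod_cast hM)) H).ne'
  -- Undoing the normalisation recovers `(B_m, B_M)` from the regressors, so the weight is a
  -- function of `G`.
  let ψ : (Fin 2 × Fin d → ℝ) → ℝ := fun x => φ (WithLp.toLp 2 fun k => (m : ℝ) ^ H * x (0, k),
    WithLp.toLp 2 fun k => (m : ℝ) ^ H * x (0, k) + ((M : ℝ) - m) ^ H * x (1, k))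
  have hψ : Measurable ψ := by
    refine hφ.comp (Measurable.prodMk ?_ ?_)
    · exact (WithLp.measurable_toLp 2 _).comp (by fun_prop)
    · exact (WithLp.measurable_toLp 2 _).comp (by fun_prop)
  have hΦψ : ∀ ω, Φ ω = ψ (G ω) := by
    intro ω
    rw [hΦ]
    simp only [ψ, hG, stdFst, stdSnd, if_true, one_ne_zero, if_false]
    congr 2
    · ext k; simp [hmH]
    · ext k; simp [hmH, hMH]
  have hUm := fun k => (hB.memLp_stdFst m k (p := 2) (by simp))
  have hVm := fun k => (hB.memLp_stdSnd m M k (p := 2) (by simp))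
  have hU1 := fun k => integrable_mul_of_sq hi (hUm k).1 (hU k)
  have hV1 := fun k => integrable_mul_of_sq hi (hVm k).1 (hV k)
  have hUU := fun k l => integrable_mul_mul_of_sq hi.1 (hUm k).1 (hUm l).1 (hU k) (hU l)
  have hUV := fun k l => integrable_mul_mul_of_sq hi.1 (hUm k).1 (hVm l).1 (hU k) (hV l)
  have hVU := fun k l => integrable_mul_mul_of_sq hi.1 (hVm k).1 (hUm l).1 (hV k) (hU l)
  have hVV := fun k l => integrable_mul_mul_of_sq hi.1 (hVm k).1 (hVm l).1 (hV k) (hV l)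
  have hXm : ∀ (r r' : ℝ≥0) k, MemLp (fun ω => B r' ω k - B r ω k) 2 P := fun r r' k =>
    (hB.memLp_eval r' k (by simp)).sub (hB.memLp_eval r k (by simp))
  have hAm : ∀ (c e : ℝ) k, MemLp (fun ω => c * stdFst H B m k ω + e * stdSnd H B m M k ω) 2 P :=
    fun c e k => ((hUm k).const_mul c).add ((hVm k).const_mul e)
  have hres : ∀ (r r' : ℝ≥0) (c e : ℝ) k, MemLp (fun ω => (B r' ω k - B r ω k) -
      (c * stdFst H B m k ω + e * stdSnd H B m M k ω)) 2 P :=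
    fun r r' c e k => (hXm r r' k).sub (hAm c e k)
  have hint0 : ∀ (r r' : ℝ≥0) (c e : ℝ) k, ∫ ω, ((B r' ω k - B r ω k) -
      (c * stdFst H B m k ω + e * stdSnd H B m M k ω)) ∂P = 0 := by
    intro r r' c e k
    rw [MeasureTheory.integral_sub ((hXm r r' k).integrable one_le_two)
      ((hAm c e k).integrable one_le_two), hB.integral_sub, integral_add
      (((hUm k).const_mul c).integrable one_le_two) (((hVm k).const_mul e).integrable one_le_two),
      integral_const_mul, integral_const_mul, hB.integral_stdFst, hB.integral_stdSnd]
    ring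
  let α : Fin d → ℝ → ℝ → (Fin 2 × Fin d → ℝ) → ℝ := fun k c e x => c * x (0, k) + e * x (1, k)
  have hα : ∀ k c e, Measurable (α k c e) := fun k c e => by fun_prop
  have hαG : ∀ k c e ω, α k c e (G ω) = c * stdFst H B m k ω + e * stdSnd H B m M k ω := by
    intro k c e ω; simp [α, hG]
  have hexp : ∀ (Ψ : Ω → ℝ),
      Integrable (fun ω => Ψ ω * (stdFst H B m i ω * stdFst H B m j ω)) P →
      Integrable (fun ω => Ψ ω * (stdFst H B m i ω * stdSnd H B m M j ω)) P →
      Integrable (fun ω => Ψ ω * (stdSnd H B m M i ω * stdFst H B m j ω)) P →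
      Integrable (fun ω => Ψ ω * (stdSnd H B m M i ω * stdSnd H B m M j ω)) P →
      Integrable (fun ω => Ψ ω * (α i a b (G ω) * α j a' b' (G ω))) P ∧
      ∫ ω, Ψ ω * (α i a b (G ω) * α j a' b' (G ω)) ∂P =
        a * a' * ∫ ω, Ψ ω * (stdFst H B m i ω * stdFst H B m j ω) ∂P +
        a * b' * ∫ ω, Ψ ω * (stdFst H B m i ω * stdSnd H B m M j ω) ∂P +
        b * a' * ∫ ω, Ψ ω * (stdSnd H B m M i ω * stdFst H B m j ω) ∂P +
        b * b' * ∫ ω, Ψ ω * (stdSnd H B m M i ω * stdSnd H B m M j ω) ∂P := by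
    intro Ψ j1 j2 j3 j4
    have e : (fun ω => Ψ ω * (α i a b (G ω) * α j a' b' (G ω))) = fun ω =>
        a * a' * (Ψ ω * (stdFst H B m i ω * stdFst H B m j ω)) +
        a * b' * (Ψ ω * (stdFst H B m i ω * stdSnd H B m M j ω)) +
        b * a' * (Ψ ω * (stdSnd H B m M i ω * stdFst H B m j ω)) +
        b * b' * (Ψ ω * (stdSnd H B m M i ω * stdSnd H B m M j ω)) := by
      ext ω; rw [hαG, hαG]; ring
    have l1 := j1.const_mul (a * a')
    have l2 := j2.const_mul (a * b')
    have l3 := j3.const_mul (b * a')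
    have l4 := j4.const_mul (b * b')
    rw [e]
    refine ⟨((l1.add l2).add l3).add l4, ?_⟩
    rw [integral_add (by exact (l1.add l2).add l3) l4, integral_add (by exact l1.add l2) l3,
      integral_add l1 l2]
    simp only [integral_const_mul]
  have E1 := hexp Φ (hUU i j) (hUV i j) (hVU i j) (hVV i j)
  -- The same expansion with weight 1 computes the residual covariance: the covariance of the raw
  -- increments and those of the regressors are known, and solving for the remaining term gives
  -- `resCov`.
  have E0 := hexp (fun _ => 1) (by simpa using! (hUm i).integrable_mul (hUm j))
    (by simpa using! (hUm i).integrable_mul (hVm j)) (by simpa using! (hVm i).integrable_mul (hUm j))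
    (by simpa using! (hVm i).integrable_mul (hVm j))
  have hΦα : ∀ k c e, Integrable (fun ω => Φ ω * α k c e (G ω)) P := by
    intro k c e
    refine (((hU1 k).const_mul c).add ((hV1 k).const_mul e)).congr (ae_of_all _ fun ω => ?_)
    simp only [Pi.add_apply, hαG]; ring
  have h1α : ∀ k c e, Integrable (fun ω => 1 * α k c e (G ω)) P := by
    intro k c e
    refine ((hAm c e k).integrable one_le_two).congr (ae_of_all _ fun ω => ?_)
    simp [hαG]
  have F1 := integral_mul_add_mul_add_of_indepFun hind hψ (hα i a b) (hα j a' b')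
    (hres s s' a b i) (hres t t' a' b' j) (hint0 s s' a b i) (hint0 t t' a' b' j)
    (by simpa only [← hΦψ] using hi) (by simpa only [← hΦψ] using hΦα i a b)
    (by simpa only [← hΦψ] using hΦα j a' b') (by simpa only [← hΦψ] using E1.1)
  have F0 := integral_mul_add_mul_add_of_indepFun hind (φ := fun _ => 1) measurable_const
    (hα i a b) (hα j a' b')
    (hres s s' a b i) (hres t t' a' b' j) (hint0 s s' a b i) (hint0 t t' a' b' j)
    (integrable_const _) (h1α i a b) (h1α j a' b') E0.1
  simp only [← hΦψ] at F1
  rw [E1.2] at F1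
  rw [E0.2] at F0
  simp only [hαG, add_sub_cancel, one_mul, integral_const, probReal_univ, smul_eq_mul] at F1 F0
  rw [F1]
  have hcov : ∀ {x y : Ω → ℝ}, MemLp x 2 P → MemLp y 2 P → ∫ ω, x ω ∂P = 0 →
      ∫ ω, x ω * y ω ∂P = cov[x, y; P] := by
    intro x y hx hy h0
    rw [covariance_eq_sub hx hy, h0, zero_mul, sub_zero]; rfl
  rw [hcov (hXm s s' i) (hXm t t' j) (hB.integral_sub s s' i)] at F0
  rw [hcov (hUm i) (hUm j) (hB.integral_stdFst m i), hcov (hUm i) (hVm j) (hB.integral_stdFst m i),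
    hcov (hVm i) (hUm j) (hB.integral_stdSnd m M i), hcov (hVm i) (hVm j) (hB.integral_stdSnd m M i),
    covariance_comm (stdSnd H B m M i) (stdFst H B m j),
    hB.covariance_stdFst_stdFst hH0 hm, hB.covariance_stdFst_stdSnd, hB.covariance_stdFst_stdSnd,
    hB.covariance_stdSnd_stdSnd hH0 hM] at F0
  rw [hB.covariance_sub_sub] at F0
  congr 2
  simp only [eq_comm (a := j)] at F0
  split_ifs at F0 ⊢
  · rw [resCov]; linarith
  · linarith

end FractionalBrownian

/-! ### Bounds and limits of the regression kernels. -/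

lemma inv_rpow_mul_rpow {x : ℝ} (hx : 0 < x) (H : ℝ) :
    (x ^ H)⁻¹ * x ^ (2 * H - 1) = x ^ (H - 1) := by
  rw [← Real.rpow_neg hx.le, ← Real.rpow_add hx]; ring_nf

/-- The weight `W(s,t) = s^{2H-2} + t^{2H-2} + |t-s|^{2H-2}` dominating the kernels. -/
noncomputable def kernelWeight (H s t : ℝ) : ℝ :=
  |s| ^ (2 * H - 2) + |t| ^ (2 * H - 2) + |t - s| ^ (2 * H - 2)

lemma kernelWeight_nonneg (H s t : ℝ) : 0 ≤ kernelWeight H s t := by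
  unfold kernelWeight; positivity

/-- A bound for the regression coefficients. -/
noncomputable def regConst (H : ℝ) : ℝ := 4 / (1 - (2 * H - 1) ^ 2)

/-- A bound for the kernels relative to `kernelWeight`. -/
noncomputable def kernelConst (H : ℝ) : ℝ := 8 / (2 * H - 1) + 8 * regConst H ^ 2

lemma regConst_pos {H : ℝ} (hH : 1 / 2 < H) (hH' : H < 1) : 0 < regConst H := by
  have : 0 < 1 - (2 * H - 1) ^ 2 := by nlinarith
  unfold regConst; positivity

lemma kernelConst_pos {H : ℝ} (hH : 1 / 2 < H) : 0 < kernelConst H := by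
  have : 0 < 2 * H - 1 := by linarith
  unfold kernelConst; positivity

/-- Each covariance of the increment with a regressor is of order `ε x^(2H-1) / x^H = ε x^(H-1)`,
where `x` is the length of the time interval of the regressor. -/
lemma abs_regCoeff_increment_le {H : ℝ} (hH : 1 / 2 < H) (hH' : H < 1) {m M : ℝ≥0} (hm : 0 < m)
    (hM : m < M) (s : ℝ) {ε : ℝ} (hε : 0 ≤ ε) :
    |regCoeff (stdCorr H m M) (covFst H m s (s + ε)) (covSnd H m M s (s + ε))| ≤
        regConst H * (ε * ((m : ℝ) ^ (H - 1) + ((M : ℝ) - m) ^ (H - 1))) ∧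
      |regCoeff (stdCorr H m M) (covSnd H m M s (s + ε)) (covFst H m s (s + ε))| ≤
        regConst H * (ε * ((m : ℝ) ^ (H - 1) + ((M : ℝ) - m) ^ (H - 1))) := by
  have hm' : (0 : ℝ) < m := hm
  have hd : (0 : ℝ) < M - m := sub_pos.2 (by exact_mod_cast hM)
  have p1 := Real.rpow_pos_of_pos hm' H
  have p2 := Real.rpow_pos_of_pos hd H
  have q1 := Real.rpow_pos_of_pos hm' (H - 1)
  have q2 := Real.rpow_pos_of_pos hd (H - 1)
  have b1 : |covFst H m s (s + ε)| ≤ 2 * (ε * ((m : ℝ) ^ (H - 1) + ((M : ℝ) - m) ^ (H - 1))) := by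
    have h := abs_incCov_le hH hH' s 0 m hε
    rw [sub_zero, abs_of_pos hm'] at h
    rw [covFst, abs_mul, abs_of_pos (inv_pos.2 p1)]
    refine (mul_le_mul_of_nonneg_left h (inv_pos.2 p1).le).trans ?_
    rw [mul_left_comm, inv_rpow_mul_rpow hm']
    nlinarith [mul_nonneg hε q2.le]
  have b2 : |covSnd H m M s (s + ε)| ≤
      2 * (ε * ((m : ℝ) ^ (H - 1) + ((M : ℝ) - m) ^ (H - 1))) := by
    have h := abs_incCov_le hH hH' s m M hε
    rw [abs_of_pos hd] at h
    rw [covSnd, abs_mul, abs_of_pos (inv_pos.2 p2)]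
    refine (mul_le_mul_of_nonneg_left h (inv_pos.2 p2).le).trans ?_
    rw [mul_left_comm, inv_rpow_mul_rpow hd]
    nlinarith [mul_nonneg hε q1.le]
  have hr := abs_stdCorr_le hH hH' hm hM
  have e : regConst H * (ε * ((m : ℝ) ^ (H - 1) + ((M : ℝ) - m) ^ (H - 1))) =
      2 / (1 - (2 * H - 1) ^ 2) * (2 * (ε * ((m : ℝ) ^ (H - 1) + ((M : ℝ) - m) ^ (H - 1)))) := by
    rw [regConst]; ring
  rw [e]
  exact ⟨abs_regCoeff_le (by linarith) hr b1 b2, abs_regCoeff_le (by linarith) hr b2 b1⟩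

lemma add_rpow_sq_le_kernelWeight {H s t : ℝ} (hs : 0 < s) (ht : 0 < t) (hst : s ≠ t) :
    ((min s t) ^ (H - 1) + (max s t - min s t) ^ (H - 1)) ^ 2 ≤ 2 * kernelWeight H s t := by
  have hsq : ∀ x : ℝ, 0 < x → (x ^ (H - 1)) ^ 2 = x ^ (2 * H - 2) := fun x hx => by
    rw [← Real.rpow_natCast, ← Real.rpow_mul hx.le]; norm_num; ring_nf
  have h1 := hsq _ (lt_min hs ht)
  have hd : max s t - min s t = |t - s| := by rw [max_sub_min_eq_abs]
  have hd0 : 0 < |t - s| := abs_pos.2 (sub_ne_zero.2 hst.symm)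
  have h2 := hsq _ hd0
  have h3 : (min s t) ^ (2 * H - 2) ≤ |s| ^ (2 * H - 2) + |t| ^ (2 * H - 2) := by
    rw [abs_of_pos hs, abs_of_pos ht]
    have := Real.rpow_pos_of_pos hs (2 * H - 2)
    have := Real.rpow_pos_of_pos ht (2 * H - 2)
    rcases min_choice s t with h | h <;> rw [h] <;> linarith
  rw [hd, kernelWeight]
  nlinarith [sq_nonneg ((min s t) ^ (H - 1) - |t - s| ^ (H - 1))]

/-- The triangle inequality for the regression formula, freed of probability: `q` bounds products of
coefficients, `I₁` and `I₂` the mass and second moments of the weight, `A` the covariance of the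
increments. -/
lemma abs_regression_sum_le {a b a' b' r e₁ e₂ e₃ e₄ q I₁ I₂ J c A : ℝ} (p : Prop) [Decidable p]
    (p₁ : |a * a'| ≤ q) (p₂ : |a * b'| ≤ q) (p₃ : |b * a'| ≤ q) (p₄ : |b * b'| ≤ q)
    (h₁ : |e₁| ≤ I₂) (h₂ : |e₂| ≤ I₂) (h₃ : |e₃| ≤ I₂) (h₄ : |e₄| ≤ I₂) (hr : |r| ≤ 1)
    (hc : |c| ≤ A) (hJ : |J| ≤ I₁) :
    |(a * a' * e₁ + a * b' * e₂ + b * a' * e₃ + b * b' * e₄) +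
        J * if p then c - (a * a' + (a * b' + b * a') * r + b * b') else 0| ≤
      (A + 4 * q) * (I₁ + I₂) := by
  have hq : 0 ≤ q := (abs_nonneg _).trans p₁
  have hA : 0 ≤ A := (abs_nonneg _).trans hc
  have hI₁ : 0 ≤ I₁ := (abs_nonneg _).trans hJ
  have hI₂ : 0 ≤ I₂ := (abs_nonneg _).trans h₁
  have hpe : ∀ {x e : ℝ}, |x| ≤ q → |e| ≤ I₂ → |x * e| ≤ q * I₂ := fun hx he => by
    rw [abs_mul]; exact mul_le_mul hx he (abs_nonneg _) hq
  have t₁ : |a * a' * e₁ + a * b' * e₂ + b * a' * e₃ + b * b' * e₄| ≤ 4 * (q * I₂) := by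
    have k₁ := hpe p₁ h₁
    have k₂ := hpe p₂ h₂
    have k₃ := hpe p₃ h₃
    have k₄ := hpe p₄ h₄
    have l₁ := abs_add_le (a * a' * e₁ + a * b' * e₂ + b * a' * e₃) (b * b' * e₄)
    have l₂ := abs_add_le (a * a' * e₁ + a * b' * e₂) (b * a' * e₃)
    have l₃ := abs_add_le (a * a' * e₁) (a * b' * e₂)
    linarith
  have t₂ : |c - (a * a' + (a * b' + b * a') * r + b * b')| ≤ A + 4 * q := by
    have i₂ : |(a * b' + b * a') * r| ≤ (q + q) * 1 := by
      rw [abs_mul]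
      exact mul_le_mul ((abs_add_le _ _).trans (add_le_add p₂ p₃)) hr (abs_nonneg _) (by linarith)
    have i₃ := abs_add_le (a * a' + (a * b' + b * a') * r) (b * b')
    have i₄ := abs_add_le (a * a') ((a * b' + b * a') * r)
    have i₅ := abs_sub c (a * a' + (a * b' + b * a') * r + b * b')
    linarith
  have t₃ : |if p then c - (a * a' + (a * b' + b * a') * r + b * b') else 0| ≤ A + 4 * q := by
    split_ifs
    · exact t₂
    · rw [abs_zero]; positivity
  refine (abs_add_le _ _).trans ?_
  rw [abs_mul]
  have t₄ := mul_le_mul hJ t₃ (abs_nonneg _) hI₁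
  have t₅ := mul_nonneg hA hI₂
  linarith

section FractionalBrownian

variable {Ω : Type*} {H : ℝ} {d : ℕ} {B : ℝ≥0 → Ω → EuclideanSpace ℝ (Fin d)}

/-- The sum of the squares of the normalised regressors at times `s` and `t`. -/
noncomputable def regSq (H : ℝ) (B : ℝ≥0 → Ω → EuclideanSpace ℝ (Fin d)) (s t : ℝ) (ω : Ω) : ℝ :=
  ∑ k, (stdFst H B (min s t).toNNReal k ω ^ 2 +
    stdSnd H B (min s t).toNNReal (max s t).toNNReal k ω ^ 2)

lemma regSq_nonneg (s t : ℝ) (ω : Ω) : 0 ≤ regSq H B s t ω :=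
  Finset.sum_nonneg fun _ _ => by positivity

lemma stdFst_sq_le_regSq (s t : ℝ) (k : Fin d) (ω : Ω) :
    stdFst H B (min s t).toNNReal k ω ^ 2 ≤ regSq H B s t ω :=
  le_trans (by linarith [sq_nonneg (stdSnd H B (min s t).toNNReal (max s t).toNNReal k ω)])
    (Finset.single_le_sum (f := fun k => stdFst H B (min s t).toNNReal k ω ^ 2 +
      stdSnd H B (min s t).toNNReal (max s t).toNNReal k ω ^ 2)
      (fun _ _ => by positivity) (Finset.mem_univ k))

lemma stdSnd_sq_le_regSq (s t : ℝ) (k : Fin d) (ω : Ω) :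
    stdSnd H B (min s t).toNNReal (max s t).toNNReal k ω ^ 2 ≤ regSq H B s t ω :=
  le_trans (by linarith [sq_nonneg (stdFst H B (min s t).toNNReal k ω)])
    (Finset.single_le_sum (f := fun k => stdFst H B (min s t).toNNReal k ω ^ 2 +
      stdSnd H B (min s t).toNNReal (max s t).toNNReal k ω ^ 2)
      (fun _ _ => by positivity) (Finset.mem_univ k))

/-- The increment `B_{s+ε} - B_s`, coordinate `i`. -/
noncomputable def increment (B : ℝ≥0 → Ω → EuclideanSpace ℝ (Fin d)) (i : Fin d) (ε s : ℝ)
    (ω : Ω) : ℝ := B (s + ε).toNNReal ω i - B s.toNNReal ω i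

variable [MeasurableSpace Ω] {P : Measure Ω}

/-- The regression formula for increments at two times `s ≠ t`, weighted by a function of
`(B_s, B_t)`. -/
lemma IsFBM.integral_mul_increments (hH : 1 / 2 < H) (hH' : H < 1)
    (hB : IsFBM P H d B) {s t : ℝ} (hs : 0 < s) (ht : 0 < t) (hst : s ≠ t) (i j : Fin d)
    {φ : EuclideanSpace ℝ (Fin d) × EuclideanSpace ℝ (Fin d) → ℝ} (hφ : Measurable φ)
    {Φ : Ω → ℝ} (hΦ : Φ = fun ω => φ (B s.toNNReal ω, B t.toNNReal ω))
    (hi : Integrable Φ P) (hS : Integrable (fun ω => Φ ω * regSq H B s t ω) P) :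
    ∃ e₁ e₂ e₃ e₄ : ℝ, |e₁| ≤ ∫ ω, |Φ ω| * regSq H B s t ω ∂P ∧
      |e₂| ≤ ∫ ω, |Φ ω| * regSq H B s t ω ∂P ∧ |e₃| ≤ ∫ ω, |Φ ω| * regSq H B s t ω ∂P ∧
      |e₄| ≤ ∫ ω, |Φ ω| * regSq H B s t ω ∂P ∧
      ∀ m M : ℝ≥0, m = (min s t).toNNReal → M = (max s t).toNNReal → ∀ ε δ : ℝ, 0 ≤ ε → 0 ≤ δ →
      ∀ r a b a' b' : ℝ, r = stdCorr H m M →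
        a = regCoeff r (covFst H m s (s + ε)) (covSnd H m M s (s + ε)) →
        b = regCoeff r (covSnd H m M s (s + ε)) (covFst H m s (s + ε)) →
        a' = regCoeff r (covFst H m t (t + δ)) (covSnd H m M t (t + δ)) →
        b' = regCoeff r (covSnd H m M t (t + δ)) (covFst H m t (t + δ)) →
      ∫ ω, Φ ω * (increment B i ε s ω * increment B j δ t ω) ∂P =
        (a * a' * e₁ + a * b' * e₂ + b * a' * e₃ + b * b' * e₄) +
          (∫ ω, Φ ω ∂P) * if i = j then resCov H r a b a' b' s (s + ε) t (t + δ) else 0 := by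
  set m := (min s t).toNNReal with hmdef
  set M := (max s t).toNNReal with hMdef
  have hm : 0 < m := Real.toNNReal_pos.2 (lt_min hs ht)
  have hM : m < M := (Real.toNNReal_lt_toNNReal_iff (lt_max_of_lt_left hs)).2
    (min_lt_max.2 hst)
  have hmabs : AEStronglyMeasurable Φ P := hi.1
  have hUm := fun k => (hB.memLp_stdFst m k (p := 2) (by simp)).1
  have hVm := fun k => (hB.memLp_stdSnd m M k (p := 2) (by simp)).1
  have hSabs : Integrable (fun ω => |Φ ω| * regSq H B s t ω) P := by
    refine hS.abs.congr (ae_of_all _ fun ω => ?_)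
    simp only [abs_mul, abs_of_nonneg (regSq_nonneg (H := H) (B := B) s t ω)]
  have hdom : ∀ {x : Ω → ℝ}, AEStronglyMeasurable x P → (∀ ω, x ω ^ 2 ≤ regSq H B s t ω) →
      Integrable (fun ω => Φ ω * x ω ^ 2) P := by
    intro x hx hle
    refine hSabs.mono' (hi.1.mul (hx.pow 2)) (ae_of_all _ fun ω => ?_)
    rw [Real.norm_eq_abs, abs_mul, abs_of_nonneg (sq_nonneg (x ω))]
    exact mul_le_mul_of_nonneg_left (hle ω) (abs_nonneg _)
  have hU := fun k => hdom (hUm k) (stdFst_sq_le_regSq s t k)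
  have hV := fun k => hdom (hVm k) (stdSnd_sq_le_regSq s t k)
  have hle : ∀ {x y : Ω → ℝ}, (∀ ω, x ω ^ 2 ≤ regSq H B s t ω) →
      (∀ ω, y ω ^ 2 ≤ regSq H B s t ω) →
      |∫ ω, Φ ω * (x ω * y ω) ∂P| ≤ ∫ ω, |Φ ω| * regSq H B s t ω ∂P := by
    intro x y hx hy
    refine norm_integral_le_of_norm_le (f := fun ω => Φ ω * (x ω * y ω)) hSabs
      (ae_of_all _ fun ω => ?_)
    rw [Real.norm_eq_abs, abs_mul]
    refine mul_le_mul_of_nonneg_left ?_ (abs_nonneg _)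
    rw [abs_mul]
    have h1 := hx ω
    have h2 := hy ω
    rw [← sq_abs] at h1 h2
    nlinarith [sq_nonneg (|x ω| - |y ω|)]
  -- The four constants are weighted second moments of the regressors. They are fixed before `ε` and
  -- `δ`, so the formula can be passed to the limit in its coefficients alone.
  refine ⟨_, _, _, _, hle (stdFst_sq_le_regSq s t i) (stdFst_sq_le_regSq s t j),
    hle (stdFst_sq_le_regSq s t i) (stdSnd_sq_le_regSq s t j),
    hle (stdSnd_sq_le_regSq s t i) (stdFst_sq_le_regSq s t j),
    hle (stdSnd_sq_le_regSq s t i) (stdSnd_sq_le_regSq s t j), ?_⟩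
  rintro _ _ rfl rfl ε δ hε hδ r a b a' b' rfl rfl rfl rfl rfl
  have hr : |stdCorr H m M| < 1 := (abs_stdCorr_le hH hH' hm hM).trans_lt (by linarith)
  have cs : ((s.toNNReal : ℝ≥0) : ℝ) = s := Real.coe_toNNReal _ hs.le
  have ct : ((t.toNNReal : ℝ≥0) : ℝ) = t := Real.coe_toNNReal _ ht.le
  have cs' : (((s + ε).toNNReal : ℝ≥0) : ℝ) = s + ε := Real.coe_toNNReal _ (by linarith)
  have ct' : (((t + δ).toNNReal : ℝ≥0) : ℝ) = t + δ := Real.coe_toNNReal _ (by linarith)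
  -- The regressors are ordered in time, but the weight is given in terms of `(s, t)`; for `t ≤ s`
  -- its arguments are swapped.
  obtain ⟨ψ, hψ, hΦψ⟩ : ∃ ψ : EuclideanSpace ℝ (Fin d) × EuclideanSpace ℝ (Fin d) → ℝ,
      Measurable ψ ∧ Φ = fun ω => ψ (B m ω, B M ω) := by
    rcases le_total s t with h | h
    · exact ⟨φ, hφ, by rw [hΦ, hmdef, hMdef, min_eq_left h, max_eq_right h]⟩
    · exact ⟨φ ∘ Prod.swap, hφ.comp measurable_swap, by
        rw [hΦ, hmdef, hMdef, min_eq_right h, max_eq_left h]; rfl⟩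
  have := hB.integral_mul_increment_mul_increment hH hH' hm hM s.toNNReal (s + ε).toNNReal
    t.toNNReal (t + δ).toNNReal i j
    (regCoeff_add hr _ _) (regCoeff_add hr _ _) (regCoeff_add hr _ _) (regCoeff_add hr _ _)
    hψ hΦψ hi hU hV
  simp only [cs, ct, cs', ct'] at this
  exact this

/-- A product of two coefficients is at most `2 K² εδ W` with `K = regConst H`. Four of these,
together with the covariance bound `8/(2H-1) εδ W`, make up `kernelConst H`. -/
lemma IsFBM.abs_integral_mul_increments_le (hH : 1 / 2 < H) (hH' : H < 1)
    (hB : IsFBM P H d B) {s t : ℝ} (hs : 0 < s) (ht : 0 < t) (hst : s ≠ t) (i j : Fin d)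
    {φ : EuclideanSpace ℝ (Fin d) × EuclideanSpace ℝ (Fin d) → ℝ} (hφ : Measurable φ)
    {Φ : Ω → ℝ} (hΦ : Φ = fun ω => φ (B s.toNNReal ω, B t.toNNReal ω))
    (hi : Integrable Φ P) (hS : Integrable (fun ω => Φ ω * regSq H B s t ω) P)
    {ε δ : ℝ} (hε : 0 ≤ ε) (hδ : 0 ≤ δ) :
    |∫ ω, Φ ω * (increment B i ε s ω * increment B j δ t ω) ∂P| ≤
      ε * δ * (kernelConst H * kernelWeight H s t *
        ∫ ω, |Φ ω| * (1 + regSq H B s t ω) ∂P) := by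
  obtain ⟨e₁, e₂, e₃, e₄, h₁, h₂, h₃, h₄, he⟩ :=
    hB.integral_mul_increments hH hH' hs ht hst i j hφ hΦ hi hS
  rw [he _ _ rfl rfl ε δ hε hδ _ _ _ _ _ rfl rfl rfl rfl rfl]
  set m := (min s t).toNNReal with hmdef
  set M := (max s t).toNNReal with hMdef
  have hm : 0 < m := Real.toNNReal_pos.2 (lt_min hs ht)
  have hM : m < M := (Real.toNNReal_lt_toNNReal_iff (lt_max_of_lt_left hs)).2
    (min_lt_max.2 hst)
  have cm : (m : ℝ) = min s t := Real.coe_toNNReal _ (lt_min hs ht).le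
  have cM : (M : ℝ) = max s t := Real.coe_toNNReal _ (lt_max_of_lt_left hs).le
  obtain ⟨ha, hb⟩ := abs_regCoeff_increment_le hH hH' hm hM s hε
  obtain ⟨ha', hb'⟩ := abs_regCoeff_increment_le hH hH' hm hM t hδ
  have hw := add_rpow_sq_le_kernelWeight (H := H) hs ht hst
  have hinc := abs_incCov_incCov_le hH hH' hst hε hδ
  have hr := abs_stdCorr_le hH hH' hm hM
  rw [cm, cM] at ha hb ha' hb'
  set r := stdCorr H m M
  set a := regCoeff r (covFst H m s (s + ε)) (covSnd H m M s (s + ε))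
  set b := regCoeff r (covSnd H m M s (s + ε)) (covFst H m s (s + ε))
  set a' := regCoeff r (covFst H m t (t + δ)) (covSnd H m M t (t + δ))
  set b' := regCoeff r (covSnd H m M t (t + δ)) (covFst H m t (t + δ))
  set w := (min s t) ^ (H - 1) + (max s t - min s t) ^ (H - 1) with hwdef
  set K := regConst H with hK
  set W := kernelWeight H s t with hW
  have hW0 : 0 ≤ W := kernelWeight_nonneg H s t
  have hKpos : 0 < K := regConst_pos hH hH'
  have hSabs : Integrable (fun ω => |Φ ω| * regSq H B s t ω) P := by
    refine hS.abs.congr (ae_of_all _ fun ω => ?_)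
    simp only [abs_mul, abs_of_nonneg (regSq_nonneg (H := H) (B := B) s t ω)]
  have hsplit : ∫ ω, |Φ ω| * (1 + regSq H B s t ω) ∂P =
      ∫ ω, |Φ ω| ∂P + ∫ ω, |Φ ω| * regSq H B s t ω ∂P := by
    rw [← integral_add hi.abs hSabs]; simp only [mul_add, mul_one]
  rw [hsplit]
  set I₁ := ∫ ω, |Φ ω| ∂P
  set I₂ := ∫ ω, |Φ ω| * regSq H B s t ω ∂P
  have hI₁ : |∫ ω, Φ ω ∂P| ≤ I₁ := abs_integral_le_integral_abs
  have hI₂ : 0 ≤ I₂ := (abs_nonneg _).trans h₁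
  have hI₁' : 0 ≤ I₁ := (abs_nonneg _).trans hI₁
  have hprod : ∀ {x y : ℝ}, |x| ≤ K * (ε * w) → |y| ≤ K * (δ * w) →
      |x * y| ≤ ε * δ * (2 * K ^ 2 * W) := by
    intro x y hx hy
    rw [abs_mul]
    refine (mul_le_mul hx hy (abs_nonneg _) ((abs_nonneg _).trans hx)).trans ?_
    have : 0 ≤ ε * δ * K ^ 2 := by positivity
    nlinarith [mul_le_mul_of_nonneg_left hw this]
  have hdist : |t - s| ^ (2 * H - 2) ≤ W := by
    rw [hW, kernelWeight]
    exact le_add_of_nonneg_left (by positivity)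
  have hγ : 0 < 2 * H - 1 := by linarith
  have i1 : |incCov H s (s + ε) t (t + δ)| ≤ 8 / (2 * H - 1) * ε * δ * W :=
    hinc.trans (mul_le_mul_of_nonneg_left hdist (by positivity))
  refine (abs_regression_sum_le _ (hprod ha ha') (hprod ha hb') (hprod hb ha') (hprod hb hb')
    h₁ h₂ h₃ h₄ (hr.trans (by linarith)) i1 hI₁).trans (le_of_eq ?_)
  rw [kernelConst, ← hK]; ring

/-- Coefficients divided by their step size converge because the covariances are differentiable, and
the mixed covariance by `tendsto_incCov_div_mul`. The value of the limit is immaterial. -/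
lemma IsFBM.tendsto_integral_mul_increments (hH : 1 / 2 < H) (hH' : H < 1)
    (hB : IsFBM P H d B) {s t : ℝ} (hs : 0 < s) (ht : 0 < t) (hst : s ≠ t) (i j : Fin d)
    {φ : EuclideanSpace ℝ (Fin d) × EuclideanSpace ℝ (Fin d) → ℝ} (hφ : Measurable φ)
    {Φ : Ω → ℝ} (hΦ : Φ = fun ω => φ (B s.toNNReal ω, B t.toNNReal ω))
    (hi : Integrable Φ P) (hS : Integrable (fun ω => Φ ω * regSq H B s t ω) P) :
    ∃ L, Tendsto (fun p : ℝ × ℝ => (p.1 * p.2)⁻¹ *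
        ∫ ω, Φ ω * (increment B i p.1 s ω * increment B j p.2 t ω) ∂P)
      (𝓝[>] 0 ×ˢ 𝓝[>] 0) (𝓝 L) := by
  obtain ⟨e₁, e₂, e₃, e₄, -, -, -, -, he⟩ :=
    hB.integral_mul_increments hH hH' hs ht hst i j hφ hΦ hi hS
  have he := he _ _ rfl rfl
  set m := (min s t).toNNReal
  set M := (max s t).toNNReal
  set r := stdCorr H m M
  have hcoef : ∀ x : ℝ, ∃ L₁ L₂, Tendsto
        (fun ε => regCoeff r (covFst H m x (x + ε)) (covSnd H m M x (x + ε)) / ε)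
        (𝓝[>] 0) (𝓝 L₁) ∧ Tendsto
        (fun ε => regCoeff r (covSnd H m M x (x + ε)) (covFst H m x (x + ε)) / ε)
        (𝓝[>] 0) (𝓝 L₂) := by
    intro x
    obtain ⟨l₁, hl₁⟩ := tendsto_incCov_div hH x 0 m
    obtain ⟨l₂, hl₂⟩ := tendsto_incCov_div hH x m M
    have k₁ := hl₁.const_mul ((m : ℝ) ^ H)⁻¹
    have k₂ := hl₂.const_mul (((M : ℝ) - m) ^ H)⁻¹
    refine ⟨_, _, ((k₁.sub (k₂.const_mul r)).div_const (1 - r ^ 2)).congr fun ε => ?_,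
      ((k₂.sub (k₁.const_mul r)).div_const (1 - r ^ 2)).congr fun ε => ?_⟩
    · rw [regCoeff, covFst, covSnd]; ring
    · rw [regCoeff, covFst, covSnd]; ring
  obtain ⟨A, A₂, hA, hA₂⟩ := hcoef s
  obtain ⟨A', A₂', hA', hA₂'⟩ := hcoef t
  have ha := hA.comp (tendsto_fst (f := 𝓝[>] (0 : ℝ)) (g := 𝓝[>] (0 : ℝ)))
  have hb := hA₂.comp (tendsto_fst (f := 𝓝[>] (0 : ℝ)) (g := 𝓝[>] (0 : ℝ)))
  have ha' := hA'.comp (tendsto_snd (f := 𝓝[>] (0 : ℝ)) (g := 𝓝[>] (0 : ℝ)))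
  have hb' := hA₂'.comp (tendsto_snd (f := 𝓝[>] (0 : ℝ)) (g := 𝓝[>] (0 : ℝ)))
  have hI := tendsto_incCov_div_mul hH hst
  have hR := hI.sub (((ha.mul ha').add (((ha.mul hb').add (hb.mul ha')).mul_const r)).add
    (hb.mul hb'))
  have hR' := hR.const_mul (if i = j then (1 : ℝ) else 0)
  refine ⟨_, Tendsto.congr' ?_ (((((ha.mul ha').mul_const e₁).add ((ha.mul hb').mul_const e₂)).add
    ((hb.mul ha').mul_const e₃)).add ((hb.mul hb').mul_const e₄) |>.add
    (hR'.const_mul (∫ ω, Φ ω ∂P)))⟩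
  have hpos : ∀ᶠ x : ℝ in 𝓝[>] 0, 0 < x := eventually_mem_nhdsWithin
  filter_upwards [hpos.prod_mk hpos] with p hp
  rw [he p.1 p.2 hp.1.le hp.2.le _ _ _ _ _ rfl rfl rfl rfl rfl]
  have h1 := hp.1.ne'
  have h2 := hp.2.ne'
  simp only [Function.comp_apply, resCov]
  split_ifs
  · field_simp
  · simp only [zero_mul, mul_zero, add_zero]
    field_simp

end FractionalBrownian

/-! ### The `L^q` norm of the weight on a square. -/

section KernelWeight

variable {H q u v : ℝ}

/-- The substitution `γ = 1 - (2 - 2H) q`; its positivity is exactly local integrability of the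
`q`-th power of the singularity. -/
lemma lintegral_enorm_rpow_le (hq : 1 ≤ q) (hH' : H < 1) (hqH : (2 - 2 * H) * q < 1) (huv : u ≤ v)
    (x : ℝ) :
    ∫⁻ t in Set.Icc u v, ‖|t - x| ^ (2 * H - 2)‖ₑ ^ q ≤
      ENNReal.ofReal (2 / (1 - (2 - 2 * H) * q) * (v - u) ^ (1 - (2 - 2 * H) * q)) := by
  have h0 : 0 < (2 - 2 * H) * q := by apply mul_pos <;> linarith
  refine le_trans (le_of_eq ?_) (lintegral_Icc_abs_sub_rpow_le (γ := 1 - (2 - 2 * H) * q)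
    (by linarith) (by linarith) huv x)
  refine lintegral_congr fun t => ?_
  have hnn : 0 ≤ |t - x| ^ (2 * H - 2) := by positivity
  rw [Real.enorm_eq_ofReal hnn, ENNReal.ofReal_rpow_of_nonneg hnn (by linarith),
    ← Real.rpow_mul (abs_nonneg _)]
  ring_nf

lemma volume_restrict_Icc_prod (u v : ℝ) :
    (volume : Measure (ℝ × ℝ)).restrict (Set.Icc u v ×ˢ Set.Icc u v) =
      (volume.restrict (Set.Icc u v)).prod (volume.restrict (Set.Icc u v)) := by
  rw [Measure.prod_restrict, Measure.volume_eq_prod]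

lemma eLpNorm_le_of_lintegral_le (hq : 1 ≤ q) (hqH : (2 - 2 * H) * q < 1)
    (huv : u ≤ v) {f : ℝ × ℝ → ℝ}
    (hf : ∫⁻ x in Set.Icc u v ×ˢ Set.Icc u v, ‖f x‖ₑ ^ q ≤
      ENNReal.ofReal (2 / (1 - (2 - 2 * H) * q) * (v - u) ^ (1 - (2 - 2 * H) * q)) *
        ENNReal.ofReal (v - u)) :
    eLpNorm f (ENNReal.ofReal q) (volume.restrict (Set.Icc u v ×ˢ Set.Icc u v)) ≤
      ENNReal.ofReal ((2 / (1 - (2 - 2 * H) * q)) ^ (1 / q) *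
        (v - u) ^ (2 * (H - 1) + 2 / q)) := by
  have hq0 : 0 < q := by linarith
  have hd : 0 ≤ v - u := by linarith
  have hc : 0 < 1 - (2 - 2 * H) * q := by linarith
  rw [eLpNorm_eq_lintegral_rpow_enorm_toReal (by simpa using hq0) ENNReal.ofReal_ne_top,
    ENNReal.toReal_ofReal hq0.le]
  refine (ENNReal.rpow_le_rpow hf (by positivity)).trans (le_of_eq ?_)
  rw [← ENNReal.ofReal_mul (by positivity), ENNReal.ofReal_rpow_of_nonneg (by positivity)
    (by positivity), mul_assoc, Real.mul_rpow (by positivity) (by positivity)]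
  congr 2
  -- The exponent is `((1 - (2-2H) q) + 1) / q = 2(H-1) + 2/q`. Nonnegative exponents are used for
  -- the addition rule, so `u = v` is covered.
  nth_rw 2 [← Real.rpow_one (v - u)]
  rw [← Real.rpow_add_of_nonneg hd hc.le zero_le_one, ← Real.rpow_mul hd]
  congr 1
  field_simp
  ring

/-- Each of the three singular terms is integrated in a variable in which it is a translate of `|x|
^ (2H-2)`, uniformly in the other variable, which then contributes a factor `v - u`. -/
lemma eLpNorm_kernelWeight_le (hq : 1 ≤ q) (hH' : H < 1) (hqH : (2 - 2 * H) * q < 1)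
    (huv : u ≤ v) :
    eLpNorm (fun x : ℝ × ℝ => kernelWeight H x.1 x.2) (ENNReal.ofReal q)
        (volume.restrict (Set.Icc u v ×ˢ Set.Icc u v)) ≤
      ENNReal.ofReal (3 * (2 / (1 - (2 - 2 * H) * q)) ^ (1 / q) *
        (v - u) ^ (2 * (H - 1) + 2 / q)) := by
  have hc : 0 < 1 - (2 - 2 * H) * q := by linarith
  have hd : 0 ≤ v - u := by linarith
  have hQ : 1 ≤ ENNReal.ofReal q := by simpa using hq
  have m1 : Measurable fun x : ℝ × ℝ => |x.1| ^ (2 * H - 2) := by fun_prop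
  have m2 : Measurable fun x : ℝ × ℝ => |x.2| ^ (2 * H - 2) := by fun_prop
  have m3 : Measurable fun x : ℝ × ℝ => |x.2 - x.1| ^ (2 * H - 2) := by fun_prop
  have key := fun x => lintegral_enorm_rpow_le (H := H) hq hH' hqH huv x
  have hconst : ∀ {F : ℝ → ℝ≥0∞} {K : ℝ≥0∞}, (∀ x, F x ≤ K) →
      ∫⁻ x in Set.Icc u v, F x ≤ K * ENNReal.ofReal (v - u) := by
    intro F K hF
    refine (lintegral_mono hF).trans ?_
    rw [setLIntegral_const, Real.volume_Icc]
  have e1 := eLpNorm_le_of_lintegral_le hq hqH huv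
    (f := fun x : ℝ × ℝ => |x.1| ^ (2 * H - 2)) (by
      rw [volume_restrict_Icc_prod, lintegral_prod_symm _ (by fun_prop)]
      exact hconst fun _ => by simpa using key 0)
  have e2 := eLpNorm_le_of_lintegral_le hq hqH huv
    (f := fun x : ℝ × ℝ => |x.2| ^ (2 * H - 2)) (by
      rw [volume_restrict_Icc_prod, lintegral_prod _ (by fun_prop)]
      exact hconst fun _ => by simpa using key 0)
  have e3 := eLpNorm_le_of_lintegral_le hq hqH huv
    (f := fun x : ℝ × ℝ => |x.2 - x.1| ^ (2 * H - 2)) (by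
      rw [volume_restrict_Icc_prod, lintegral_prod _ (by fun_prop)]
      exact hconst fun x => key x)
  have h12 := eLpNorm_add_le (μ := volume.restrict (Set.Icc u v ×ˢ Set.Icc u v))
    m1.aestronglyMeasurable m2.aestronglyMeasurable hQ
  have h123 := eLpNorm_add_le (μ := volume.restrict (Set.Icc u v ×ˢ Set.Icc u v))
    (m1.add m2).aestronglyMeasurable m3.aestronglyMeasurable hQ
  refine h123.trans ((add_le_add (h12.trans (add_le_add e1 e2)) e3).trans (le_of_eq ?_))
  rw [← ENNReal.ofReal_add (by positivity) (by positivity),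
    ← ENNReal.ofReal_add (by positivity) (by positivity)]
  congr 1; ring

end KernelWeight

/-! ### Gaussian moments and norms on the product space. -/

section Moments

/-- The `L^q` norm of the square of a standard normal random variable. -/
noncomputable def gaussSqNorm (q : ℝ) : ℝ≥0∞ :=
  eLpNorm (fun x : ℝ => x ^ 2) (ENNReal.ofReal q) (gaussianReal 0 1)

lemma gaussSqNorm_lt_top (q : ℝ) : gaussSqNorm q < ∞ := by
  have : ENNReal.HolderTriple (2 * ENNReal.ofReal q) (2 * ENNReal.ofReal q) (ENNReal.ofReal q) :=
    ⟨by rw [ENNReal.mul_inv (by simp) (by simp), ← add_mul, ENNReal.inv_two_add_inv_two, one_mul]⟩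
  have h := memLp_id_gaussianReal' (μ := 0) (v := 1) (2 * ENNReal.ofReal q)
    (by finiteness)
  have h2 : MemLp (fun x : ℝ => x ^ 2) (ENNReal.ofReal q) (gaussianReal 0 1) := by
    have := h.mul (r := ENNReal.ofReal q) h
    simpa [sq, Pi.mul_def] using! this
  exact h2.2

variable {Ω : Type*} [MeasurableSpace Ω] {P : Measure Ω}

lemma eLpNorm_sq_of_gaussian {X : Ω → ℝ} (hX : HasGaussianLaw X P) (h0 : ∫ ω, X ω ∂P = 0)
    (h1 : cov[X, X; P] = 1) (q : ℝ) :
    eLpNorm (fun ω => X ω ^ 2) (ENNReal.ofReal q) P = gaussSqNorm q := by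
  have hmap := hX.map_eq_gaussianReal
  rw [← covariance_self hX.aemeasurable, h1, h0, Real.toNNReal_one] at hmap
  rw [gaussSqNorm, ← hmap, eLpNorm_map_measure (by fun_prop) hX.aemeasurable]
  rfl

/-- Minkowski's integral inequality in the trivial case of equal exponents. -/
lemma eLpNorm_prod_le {X : Type*} [MeasurableSpace X] {μ : Measure X} [SFinite μ] [SFinite P]
    {F : Ω × X → ℝ} (hF : Measurable F) {q : ℝ} (hq : 0 < q) {w : X → ℝ} {c : ℝ≥0∞}
    (hw : Measurable w)
    (h : ∀ᵐ x ∂μ, eLpNorm (fun ω => F (ω, x)) (ENNReal.ofReal q) P ≤ c * ‖w x‖ₑ) :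
    eLpNorm F (ENNReal.ofReal q) (P.prod μ) ≤ c * eLpNorm w (ENNReal.ofReal q) μ := by
  have hQ0 : ENNReal.ofReal q ≠ 0 := by simpa using hq
  rw [eLpNorm_eq_lintegral_rpow_enorm_toReal hQ0 ENNReal.ofReal_ne_top,
    eLpNorm_eq_lintegral_rpow_enorm_toReal hQ0 ENNReal.ofReal_ne_top,
    ENNReal.toReal_ofReal hq.le, lintegral_prod_symm _ (by fun_prop)]
  have h' : ∀ᵐ x ∂μ, ∫⁻ ω, ‖F (ω, x)‖ₑ ^ q ∂P ≤ c ^ q * ‖w x‖ₑ ^ q := by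
    filter_upwards [h] with x hx
    rw [eLpNorm_eq_lintegral_rpow_enorm_toReal hQ0 ENNReal.ofReal_ne_top,
      ENNReal.toReal_ofReal hq.le] at hx
    have := ENNReal.rpow_le_rpow hx hq.le
    rwa [← ENNReal.rpow_mul, one_div, inv_mul_cancel₀ hq.ne', ENNReal.rpow_one,
      ENNReal.mul_rpow_of_nonneg _ _ hq.le] at this
  have h2 := lintegral_mono_ae h'
  rw [lintegral_const_mul _ (by fun_prop)] at h2
  refine (ENNReal.rpow_le_rpow h2 (by positivity)).trans (le_of_eq ?_)
  rw [ENNReal.mul_rpow_of_nonneg _ _ (by positivity), ← ENNReal.rpow_mul, one_div,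
    mul_inv_cancel₀ hq.ne', ENNReal.rpow_one]

variable {H : ℝ} {d : ℕ} {B : ℝ≥0 → Ω → EuclideanSpace ℝ (Fin d)}

lemma IsFBM.hasGaussianLaw_sub (hB : IsFBM P H d B) (s s' : ℝ≥0) (c : ℝ) (k : Fin d) :
    HasGaussianLaw (fun ω => c * (B s' ω k - B s ω k)) P := by
  have h := (hB.isGaussianProcess.hasGaussianLaw_sub (s := s') (t := s)).map
    (c • EuclideanSpace.proj (𝕜 := ℝ) k)
  convert! h using 1

lemma IsFBM.eLpNorm_stdFst_sq (hH : 0 < H) (hB : IsFBM P H d B) {m : ℝ≥0} (hm : 0 < m) (k : Fin d)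
    (q : ℝ) :
    eLpNorm (fun ω => stdFst H B m k ω ^ 2) (ENNReal.ofReal q) P = gaussSqNorm q := by
  refine eLpNorm_sq_of_gaussian ?_ (hB.integral_stdFst m k)
    (by rw [hB.covariance_stdFst_stdFst hH hm, if_pos rfl]) q
  have h := (hB.isGaussianProcess.hasGaussianLaw_eval m).map
    (((m : ℝ) ^ H)⁻¹ • EuclideanSpace.proj (𝕜 := ℝ) k)
  convert! h using 1

lemma IsFBM.eLpNorm_stdSnd_sq (hH : 0 < H) (hB : IsFBM P H d B) {m M : ℝ≥0} (hM : m < M)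
    (k : Fin d) (q : ℝ) :
    eLpNorm (fun ω => stdSnd H B m M k ω ^ 2) (ENNReal.ofReal q) P = gaussSqNorm q :=
  eLpNorm_sq_of_gaussian (X := stdSnd H B m M k) (hB.hasGaussianLaw_sub m M _ k)
    (hB.integral_stdSnd m M k) (by rw [hB.covariance_stdSnd_stdSnd hH hM, if_pos rfl]) q

/-- A bound for the `L^q(P)` norm of `1 + regSq`. -/
noncomputable def regSqNorm (q : ℝ) (d : ℕ) : ℝ≥0∞ := 1 + d * (gaussSqNorm q + gaussSqNorm q)

lemma regSqNorm_lt_top (q : ℝ) (d : ℕ) : regSqNorm q d < ∞ := by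
  have := gaussSqNorm_lt_top q
  unfold regSqNorm; finiteness

/-- All regressors are standard normal, so the bound does not depend on `s` and `t`; all singular
behaviour has been moved into the weight. -/
lemma IsFBM.eLpNorm_one_add_regSq_le (hH : 0 < H) (hB : IsFBM P H d B) {s t : ℝ} (hs : 0 < s)
    (ht : 0 < t) (hst : s ≠ t) {q : ℝ} (hq : 1 ≤ q) :
    eLpNorm (fun ω => 1 + regSq H B s t ω) (ENNReal.ofReal q) P ≤ regSqNorm q d := by
  have := hB.isProbabilityMeasure
  have hQ : 1 ≤ ENNReal.ofReal q := by simpa using hq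
  have hm : 0 < (min s t).toNNReal := Real.toNNReal_pos.2 (lt_min hs ht)
  have hM : (min s t).toNNReal < (max s t).toNNReal :=
    (Real.toNNReal_lt_toNNReal_iff (lt_max_of_lt_left hs)).2 (min_lt_max.2 hst)
  have mU := fun k => (hB.memLp_stdFst (min s t).toNNReal k (p := 2) (by simp)).1.pow 2
  have mV := fun k =>
    (hB.memLp_stdSnd (min s t).toNNReal (max s t).toNNReal k (p := 2) (by simp)).1.pow 2
  have hsum : regSq H B s t = ∑ k, ((stdFst H B (min s t).toNNReal k) ^ 2 +
      (stdSnd H B (min s t).toNNReal (max s t).toNNReal k) ^ 2) := by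
    ext ω; simp [regSq]
  have h1 : eLpNorm (regSq H B s t) (ENNReal.ofReal q) P ≤
      d * (gaussSqNorm q + gaussSqNorm q) := by
    rw [hsum]
    refine (eLpNorm_sum_le (fun k _ => (mU k).add (mV k)) hQ).trans ?_
    refine (Finset.sum_le_sum (g := fun _ => gaussSqNorm q + gaussSqNorm q) fun k _ =>
      (eLpNorm_add_le (mU k) (mV k) hQ).trans (add_le_add (le_of_eq ?_) (le_of_eq ?_))).trans ?_
    · exact hB.eLpNorm_stdFst_sq hH hm k q
    · exact hB.eLpNorm_stdSnd_sq hH hM k q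
    · simp [mul_add]
  refine (eLpNorm_add_le (f := fun _ => (1 : ℝ)) (g := regSq H B s t)
    aestronglyMeasurable_const ?_ hQ).trans (add_le_add ?_ h1)
  · rw [hsum]; exact Finset.aestronglyMeasurable_sum _ fun k _ => (mU k).add (mV k)
  · rw [eLpNorm_const _ (by simp; linarith) (IsProbabilityMeasure.ne_zero P)]; simp

/-- The increment is `ε^H` times a second regressor for the times `s < s + ε`. -/
lemma IsFBM.eLpNorm_increment_sq (hH : 0 < H) (hB : IsFBM P H d B) (i : Fin d) {ε s : ℝ}
    (hε : 0 < ε) (hs : 0 ≤ s) (q : ℝ) :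
    eLpNorm (fun ω => increment B i ε s ω ^ 2) (ENNReal.ofReal q) P =
      ‖(ε ^ H) ^ 2‖ₑ * gaussSqNorm q := by
  have hp := Real.rpow_pos_of_pos hε H
  have hlt : s.toNNReal < (s + ε).toNNReal :=
    (Real.toNNReal_lt_toNNReal_iff (by linarith)).2 (by linarith)
  have h := hB.eLpNorm_stdSnd_sq hH hlt i q
  rw [← h, ← eLpNorm_const_smul]
  congr 1
  ext ω
  simp only [stdSnd, increment, Pi.smul_apply, smul_eq_mul]
  rw [Real.coe_toNNReal _ hs, Real.coe_toNNReal _ (by linarith : 0 ≤ s + ε), add_sub_cancel_left]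
  field_simp

section JointlyMeasurable

lemma measurable_eval_coord (hm : Measurable (Function.uncurry B)) {X : Type*} [MeasurableSpace X]
    {f : X → ℝ} {g : X → Ω} (hf : Measurable f) (hg : Measurable g) (i : Fin d) :
    Measurable fun x => B (f x).toNNReal (g x) i := by
  have h1 : Measurable fun x => B (f x).toNNReal (g x) := hm.comp (hf.real_toNNReal.prodMk hg)
  fun_prop

lemma measurable_increment (hm : Measurable (Function.uncurry B)) {X : Type*} [MeasurableSpace X]
    {f : X → ℝ} {g : X → Ω} (hf : Measurable f) (hg : Measurable g) (i : Fin d) (ε : ℝ) :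
    Measurable fun x => increment B i ε (f x) (g x) :=
  (measurable_eval_coord hm (hf.add_const ε) hg i).sub (measurable_eval_coord hm hf hg i)

lemma measurable_regSq (hm : Measurable (Function.uncurry B)) :
    Measurable fun x : Ω × (ℝ × ℝ) => regSq H B x.2.1 x.2.2 x.1 := by
  unfold regSq stdFst stdSnd
  refine Finset.measurable_sum _ fun k _ => ?_
  have h1 : Measurable fun x : Ω × (ℝ × ℝ) => B (min x.2.1 x.2.2).toNNReal x.1 k :=
    measurable_eval_coord hm (by fun_prop) (by fun_prop) k
  have h2 : Measurable fun x : Ω × (ℝ × ℝ) => B (max x.2.1 x.2.2).toNNReal x.1 k :=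
    measurable_eval_coord hm (by fun_prop) (by fun_prop) k
  fun_prop

lemma measurable_kernelWeight : Measurable fun x : ℝ × ℝ => kernelWeight H x.1 x.2 := by
  unfold kernelWeight; fun_prop

/-- The regression degenerates only on the axes and on the diagonal, which are null sets. -/
lemma ae_restrict_Icc_prod {u : ℝ} (hu : 0 ≤ u) (v : ℝ) :
    ∀ᵐ x ∂(volume : Measure (ℝ × ℝ)).restrict (Set.Icc u v ×ˢ Set.Icc u v),
      0 < x.1 ∧ 0 < x.2 ∧ x.1 ≠ x.2 := by
  have hmem := ae_restrict_mem (μ := (volume : Measure (ℝ × ℝ)))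
    ((measurableSet_Icc (a := u) (b := v)).prod (measurableSet_Icc (a := u) (b := v)))
  have h1 : ∀ᵐ x : ℝ × ℝ, x.1 ≠ 0 :=
    Measure.quasiMeasurePreserving_fst.ae (p := fun y : ℝ => y ≠ 0) (Measure.ae_ne volume 0)
  have h2 : ∀ᵐ x : ℝ × ℝ, x.2 ≠ 0 :=
    Measure.quasiMeasurePreserving_snd.ae (p := fun y : ℝ => y ≠ 0) (Measure.ae_ne volume 0)
  have h3 : ∀ᵐ x : ℝ × ℝ, x.1 ≠ x.2 := by
    rw [Measure.volume_eq_prod]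
    refine (Measure.ae_prod_iff_ae_ae ?_).2 (ae_of_all _ fun x => ?_)
    · exact (measurableSet_eq_fun measurable_fst measurable_snd).compl
    · filter_upwards [Measure.ae_ne volume x] with y hy using hy.symm
  filter_upwards [hmem, ae_restrict_of_ae h1, ae_restrict_of_ae h2, ae_restrict_of_ae h3]
    with x hx h1 h2 h3
  exact ⟨lt_of_le_of_ne (hu.trans hx.1.1) h1.symm, lt_of_le_of_ne (hu.trans hx.2.1) h2.symm, h3⟩

/-- The `L^q(Ω × [u,v]²)` norm of the dominating kernel. -/
lemma IsFBM.eLpNorm_kernelWeight_mul_le (hH : 1 / 2 < H) (hH' : H < 1) (hB : IsFBM P H d B)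
    (hm : Measurable (Function.uncurry B)) {q u v : ℝ} (hq : 1 ≤ q) (hqH : (2 - 2 * H) * q < 1)
    (hu : 0 ≤ u) (huv : u ≤ v) :
    eLpNorm (fun x : Ω × (ℝ × ℝ) => kernelWeight H x.2.1 x.2.2 * (1 + regSq H B x.2.1 x.2.2 x.1))
      (ENNReal.ofReal q) (P.prod (volume.restrict (Set.Icc u v ×ˢ Set.Icc u v))) ≤
      regSqNorm q d * ENNReal.ofReal (3 * (2 / (1 - (2 - 2 * H) * q)) ^ (1 / q) *
        (v - u) ^ (2 * (H - 1) + 2 / q)) := by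
  have := hB.isProbabilityMeasure
  refine (eLpNorm_prod_le (F := fun x : Ω × (ℝ × ℝ) =>
      kernelWeight H x.2.1 x.2.2 * (1 + regSq H B x.2.1 x.2.2 x.1))
    ((measurable_kernelWeight.comp measurable_snd).mul
      (measurable_const.add (measurable_regSq hm))) (by linarith) measurable_kernelWeight ?_).trans
    (mul_le_mul_right (eLpNorm_kernelWeight_le hq hH' hqH huv) _)
  filter_upwards [ae_restrict_Icc_prod hu v] with x hx
  have := hB.eLpNorm_one_add_regSq_le (by linarith) hx.1 hx.2.1 hx.2.2 hq
  rw [mul_comm]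
  refine le_trans (le_of_eq ?_) (mul_le_mul_right this _)
  exact eLpNorm_const_smul (kernelWeight H x.1 x.2) (fun ω => 1 + regSq H B x.1 x.2 ω) _ _

lemma IsFBM.memLp_increment_sq (hH : 0 < H) (hB : IsFBM P H d B)
    (hm : Measurable (Function.uncurry B)) {q u v : ℝ} (hq : 1 ≤ q) (hu : 0 ≤ u) (i : Fin d)
    {ε : ℝ} (hε : 0 < ε) {f : ℝ × ℝ → ℝ} (hf : Measurable f)
    (hfu : ∀ x ∈ Set.Icc u v ×ˢ Set.Icc u v, f x ∈ Set.Icc u v) :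
    MemLp (fun x : Ω × (ℝ × ℝ) => increment B i ε (f x.2) x.1 ^ 2) (ENNReal.ofReal q)
      (P.prod (volume.restrict (Set.Icc u v ×ˢ Set.Icc u v))) := by
  have := hB.isProbabilityMeasure
  have hmeas : Measurable fun x : Ω × (ℝ × ℝ) => increment B i ε (f x.2) x.1 ^ 2 :=
    (measurable_increment hm (hf.comp measurable_snd) measurable_fst i ε).pow_const 2
  have : IsFiniteMeasure ((volume : Measure (ℝ × ℝ)).restrict (Set.Icc u v ×ˢ Set.Icc u v)) := by
    rw [volume_restrict_Icc_prod]; infer_instance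
  refine ⟨hmeas.aestronglyMeasurable, (eLpNorm_prod_le hmeas (by linarith)
    (w := fun _ => (1 : ℝ)) (c := ‖(ε ^ H) ^ 2‖ₑ * gaussSqNorm q) measurable_const ?_).trans_lt ?_⟩
  · filter_upwards [ae_restrict_mem ((measurableSet_Icc (a := u) (b := v)).prod
      (measurableSet_Icc (a := u) (b := v)))] with x hx
    rw [hB.eLpNorm_increment_sq hH i hε (hu.trans (hfu x hx).1)]; simp
  · exact ENNReal.mul_lt_top (ENNReal.mul_lt_top (by finiteness) (gaussSqNorm_lt_top q))
      (memLp_const 1).2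

end JointlyMeasurable

end Moments

/-! ### A convergence criterion in L². -/

/-- In a Hilbert space, a family whose mutual inner products converge is convergent. -/
lemma exists_tendsto_of_tendsto_inner {E α : Type*} [NormedAddCommGroup E] [InnerProductSpace ℝ E]
    [CompleteSpace E] {l : Filter α} [l.NeBot] {f : α → E} {c : ℝ}
    (h : Tendsto (fun p : α × α => inner ℝ (f p.1) (f p.2)) (l ×ˢ l) (𝓝 c)) :
    ∃ x, Tendsto f l (𝓝 x) ∧ ‖x‖ ^ 2 = c := by
  -- Restricting the joint limit to the diagonal gives squared norms with the same limit `c`; hence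
  -- `‖f a - f b‖²` tends to `c - 2c + c = 0`.
  have hdiag : Tendsto (fun a => inner ℝ (f a) (f a)) l (𝓝 c) :=
    h.comp (tendsto_id.prodMk tendsto_id)
  have h1 := hdiag.comp (tendsto_fst (f := l) (g := l))
  have h2 := hdiag.comp (tendsto_snd (f := l) (g := l))
  have hsq : Tendsto (fun p : α × α => dist (f p.1) (f p.2) ^ 2) (l ×ˢ l) (𝓝 0) := by
    have := (h1.sub (h.const_mul 2)).add h2
    rw [show c - 2 * c + c = 0 by ring] at this
    refine this.congr fun p => ?_
    rw [dist_eq_norm, norm_sub_sq_real]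
    simp only [Function.comp_apply, real_inner_self_eq_norm_sq]
  have hdist : Tendsto (fun p : α × α => dist (f p.1) (f p.2)) (l ×ˢ l) (𝓝 0) := by
    have := (Real.continuous_sqrt.tendsto 0).comp hsq
    rw [Real.sqrt_zero] at this
    exact this.congr fun p => Real.sqrt_sq dist_nonneg
  have hcauchy : Cauchy (map f l) :=
    cauchy_map_iff.2 ⟨inferInstance, tendsto_uniformity_iff_dist_tendsto_zero.2 hdist⟩
  obtain ⟨x, hx⟩ := CompleteSpace.complete hcauchy
  refine ⟨x, hx, tendsto_nhds_unique ?_ hdiag⟩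
  have := (show Tendsto f l (𝓝 x) from hx).inner (𝕜 := ℝ) (show Tendsto f l (𝓝 x) from hx)
  rwa [real_inner_self_eq_norm_sq] at this

section

variable {Ω : Type*} [MeasurableSpace Ω] {P : Measure Ω}

/-- The `L²(P)` version of `exists_tendsto_of_tendsto_inner`. -/
lemma exists_memLp_tendsto_of_tendsto_integral_mul {α : Type*} {l : Filter α} [l.NeBot]
    {J : α → Ω → ℝ} (hJ : ∀ᶠ a in l, MemLp (J a) 2 P) {c : ℝ}
    (h : Tendsto (fun p : α × α => ∫ ω, J p.1 ω * J p.2 ω ∂P) (l ×ˢ l) (𝓝 c)) :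
    ∃ I : Ω → ℝ, MemLp I 2 P ∧ Tendsto (fun a => eLpNorm (J a - I) 2 P) l (𝓝 0) ∧
      (eLpNorm I 2 P).toReal ^ 2 = c := by
  classical
  let f : α → Lp ℝ 2 P := fun a => if ha : MemLp (J a) 2 P then ha.toLp (J a) else 0
  have hf : ∀ a (ha : MemLp (J a) 2 P), f a = ha.toLp (J a) := fun a ha => dif_pos ha
  have hinner : Tendsto (fun p : α × α => inner ℝ (f p.1) (f p.2)) (l ×ˢ l) (𝓝 c) := by
    refine h.congr' ?_
    filter_upwards [hJ.prod_mk hJ] with p hp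
    rw [hf _ hp.1, hf _ hp.2, L2.inner_def]
    refine integral_congr_ae ?_
    filter_upwards [hp.1.coeFn_toLp, hp.2.coeFn_toLp] with ω h1 h2
    rw [h1, h2]; simp [mul_comm]
  obtain ⟨x, hx, hxc⟩ := exists_tendsto_of_tendsto_inner hinner
  refine ⟨x, Lp.memLp x, ?_, by rw [← hxc, Lp.norm_def]⟩
  have := (Lp.tendsto_Lp_iff_tendsto_eLpNorm' f x).1 hx
  refine this.congr' ?_
  filter_upwards [hJ] with a ha
  refine eLpNorm_congr_ae ?_
  rw [hf _ ha]
  filter_upwards [ha.coeFn_toLp] with ω h1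
  simp [h1]

end

lemma abs_mul_le_norm_tensor {d : ℕ} (a b : EuclideanSpace ℝ (Fin d)) (i j : Fin d) :
    |a i * b j| ≤ ‖tensor a b‖ :=
  PiLp.norm_apply_le (tensor a b) (i, j)

/-! ### Second moments of the forward approximations. -/

section Integrands

variable {Ω : Type*} {H : ℝ} {d : ℕ} {B : ℝ≥0 → Ω → EuclideanSpace ℝ (Fin d)}
  {g : ℝ → EuclideanSpace ℝ (Fin d) → EuclideanSpace ℝ (Fin d)}

lemma forwardIntegrand_eq_sum (Y : ℝ → Ω → EuclideanSpace ℝ (Fin d)) (ε : ℝ) (ω : Ω) (s : ℝ) :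
    forwardIntegrand B Y ε ω s = ∑ i, Y s ω i * increment B i ε s ω := by
  simp [forwardIntegrand, increment, PiLp.inner_apply, mul_comm]

/-- The integrands of the second moments of the forward approximations. -/
noncomputable def momentIntegrand (g : ℝ → EuclideanSpace ℝ (Fin d) → EuclideanSpace ℝ (Fin d))
    (B : ℝ≥0 → Ω → EuclideanSpace ℝ (Fin d)) (i j : Fin d) (ε δ : ℝ) (x : Ω × (ℝ × ℝ)) : ℝ :=
  integrandProcess g B x.2.1 x.1 i * integrandProcess g B x.2.2 x.1 j *
    (increment B i ε x.2.1 x.1 * increment B j δ x.2.2 x.1)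

lemma forwardIntegrand_mul_forwardIntegrand (ε δ : ℝ) (ω : Ω) (x : ℝ × ℝ) :
    forwardIntegrand B (integrandProcess g B) ε ω x.1 *
        forwardIntegrand B (integrandProcess g B) δ ω x.2 =
      ∑ i, ∑ j, momentIntegrand g B i j ε δ (ω, x) := by
  rw [forwardIntegrand_eq_sum, forwardIntegrand_eq_sum, Finset.sum_mul_sum]
  refine Finset.sum_congr rfl fun i _ => Finset.sum_congr rfl fun j _ => ?_
  rw [momentIntegrand]; ring

/-- The dominating kernel `‖Y_s ⊗ Y_t‖ W(s,t) (1 + regSq)`. -/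
noncomputable def momentBound (H : ℝ)
    (g : ℝ → EuclideanSpace ℝ (Fin d) → EuclideanSpace ℝ (Fin d))
    (B : ℝ≥0 → Ω → EuclideanSpace ℝ (Fin d)) (x : Ω × (ℝ × ℝ)) : ℝ :=
  ‖tensorSquare (integrandProcess g B) x‖ *
    (kernelWeight H x.2.1 x.2.2 * (1 + regSq H B x.2.1 x.2.2 x.1))

lemma momentBound_nonneg (x : Ω × (ℝ × ℝ)) : 0 ≤ momentBound H g B x := by
  have := regSq_nonneg (H := H) (B := B) x.2.1 x.2.2 x.1
  have := kernelWeight_nonneg H x.2.1 x.2.2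
  unfold momentBound; positivity

end Integrands

section SecondMoments

variable {Ω : Type*} [MeasurableSpace Ω] {P : Measure Ω} {H : ℝ} {d : ℕ}
  {B : ℝ≥0 → Ω → EuclideanSpace ℝ (Fin d)}
  {g : ℝ → EuclideanSpace ℝ (Fin d) → EuclideanSpace ℝ (Fin d)}

lemma measurable_integrandProcess (hm : Measurable (Function.uncurry B))
    (hg : Measurable (Function.uncurry g)) {X : Type*} [MeasurableSpace X]
    {f : X → ℝ} {h : X → Ω} (hf : Measurable f) (hh : Measurable h) :
    Measurable fun x => integrandProcess g B (f x) (h x) :=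
  hg.comp (hf.prodMk (hm.comp (hf.real_toNNReal.prodMk hh)))

lemma measurable_forwardIntegrand (hm : Measurable (Function.uncurry B))
    (hg : Measurable (Function.uncurry g)) (ε : ℝ) :
    Measurable fun x : Ω × ℝ => forwardIntegrand B (integrandProcess g B) ε x.1 x.2 := by
  simp only [forwardIntegrand_eq_sum]
  refine Finset.measurable_sum _ fun i _ => Measurable.mul ?_ ?_
  · have := measurable_integrandProcess hm hg (measurable_snd (α := Ω) (β := ℝ)) measurable_fst
    fun_prop
  · exact measurable_increment hm measurable_snd measurable_fst i ε

variable {p : ℝ≥0∞} {q u v : ℝ}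

/-- For fixed step sizes, Hölder with Gaussian moments of the increments suffices. This licenses
Fubini; the uniform control in `ε` and `δ` comes from `momentBound`. -/
lemma IsFBM.integrable_momentIntegrand (hH : 0 < H) (hB : IsFBM P H d B)
    (hm : Measurable (Function.uncurry B)) (hg : Measurable (Function.uncurry g))
    (hpq : ENNReal.HolderConjugate p (ENNReal.ofReal q)) (hq : 1 ≤ q) (hu : 0 ≤ u)
    (hY : MemLp (tensorSquare (integrandProcess g B)) p
      (P.prod (volume.restrict (Set.Icc u v ×ˢ Set.Icc u v)))) (i j : Fin d)
    {ε δ : ℝ} (hε : 0 < ε) (hδ : 0 < δ) :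
    Integrable (momentIntegrand g B i j ε δ)
      (P.prod (volume.restrict (Set.Icc u v ×ˢ Set.Icc u v))) := by
  have m1 : Measurable fun x : Ω × (ℝ × ℝ) => integrandProcess g B x.2.1 x.1 :=
    measurable_integrandProcess hm hg (by fun_prop) measurable_fst
  have m2 : Measurable fun x : Ω × (ℝ × ℝ) => integrandProcess g B x.2.2 x.1 :=
    measurable_integrandProcess hm hg (by fun_prop) measurable_fst
  have n1 : Measurable fun x : Ω × (ℝ × ℝ) => increment B i ε x.2.1 x.1 :=
    measurable_increment hm (by fun_prop) measurable_fst i ε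
  have n2 : Measurable fun x : Ω × (ℝ × ℝ) => increment B j δ x.2.2 x.1 :=
    measurable_increment hm (by fun_prop) measurable_fst j δ
  have h1 : MemLp (fun x : Ω × (ℝ × ℝ) => integrandProcess g B x.2.1 x.1 i *
      integrandProcess g B x.2.2 x.1 j) p
      (P.prod (volume.restrict (Set.Icc u v ×ˢ Set.Icc u v))) := by
    refine hY.mono (Measurable.aestronglyMeasurable (by fun_prop)) (ae_of_all _ fun x => ?_)
    exact abs_mul_le_norm_tensor _ _ i j
  have k1 := hB.memLp_increment_sq hH hm hq hu i hε (v := v) measurable_fst fun x hx => hx.1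
  have k2 := hB.memLp_increment_sq hH hm hq hu j hδ (v := v) measurable_snd fun x hx => hx.2
  have h2 : MemLp (fun x : Ω × (ℝ × ℝ) => increment B i ε x.2.1 x.1 * increment B j δ x.2.2 x.1)
      (ENNReal.ofReal q) (P.prod (volume.restrict (Set.Icc u v ×ˢ Set.Icc u v))) := by
    refine (k1.add k2).mono (n1.mul n2).aestronglyMeasurable (ae_of_all _ fun x => ?_)
    simp only [Pi.add_apply, Real.norm_eq_abs]
    rw [abs_of_nonneg (by positivity : 0 ≤ increment B i ε x.2.1 x.1 ^ 2 +
      increment B j δ x.2.2 x.1 ^ 2), abs_le]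
    constructor
    · nlinarith [sq_nonneg (increment B i ε x.2.1 x.1 + increment B j δ x.2.2 x.1)]
    · nlinarith [sq_nonneg (increment B i ε x.2.1 x.1 - increment B j δ x.2.2 x.1)]
  exact h1.integrable_mul h2

lemma IsFBM.integrable_momentBound (hH : 1 / 2 < H) (hH' : H < 1) (hB : IsFBM P H d B)
    (hm : Measurable (Function.uncurry B))
    (hpq : ENNReal.HolderConjugate p (ENNReal.ofReal q)) (hq : 1 ≤ q)
    (hqH : (2 - 2 * H) * q < 1) (hu : 0 ≤ u) (huv : u ≤ v)
    (hY : MemLp (tensorSquare (integrandProcess g B)) p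
      (P.prod (volume.restrict (Set.Icc u v ×ˢ Set.Icc u v)))) :
    Integrable (momentBound H g B) (P.prod (volume.restrict (Set.Icc u v ×ˢ Set.Icc u v))) ∧
    ∫ x, momentBound H g B x ∂(P.prod (volume.restrict (Set.Icc u v ×ˢ Set.Icc u v))) ≤
      (eLpNorm (tensorSquare (integrandProcess g B)) p
        (P.prod (volume.restrict (Set.Icc u v ×ˢ Set.Icc u v)))).toReal *
      ((regSqNorm q d).toReal * (3 * (2 / (1 - (2 - 2 * H) * q)) ^ (1 / q) *
        (v - u) ^ (2 * (H - 1) + 2 / q))) := by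
  set μ := P.prod ((volume : Measure (ℝ × ℝ)).restrict (Set.Icc u v ×ˢ Set.Icc u v))
  have hc : 0 < 1 - (2 - 2 * H) * q := by linarith
  have hd : 0 ≤ v - u := by linarith
  have hD := hB.eLpNorm_kernelWeight_mul_le hH hH' hm hq hqH hu huv
  have hmD : Measurable (fun x : Ω × (ℝ × ℝ) =>
      kernelWeight H x.2.1 x.2.2 * (1 + regSq H B x.2.1 x.2.2 x.1)) :=
    (measurable_kernelWeight.comp measurable_snd).mul (measurable_const.add (measurable_regSq hm))
  have hfin : regSqNorm q d * ENNReal.ofReal (3 * (2 / (1 - (2 - 2 * H) * q)) ^ (1 / q) *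
        (v - u) ^ (2 * (H - 1) + 2 / q)) < ∞ :=
    ENNReal.mul_lt_top (regSqNorm_lt_top q d) ENNReal.ofReal_lt_top
  have hDm : MemLp (fun x : Ω × (ℝ × ℝ) =>
      kernelWeight H x.2.1 x.2.2 * (1 + regSq H B x.2.1 x.2.2 x.1)) (ENNReal.ofReal q) μ :=
    ⟨hmD.aestronglyMeasurable, hD.trans_lt hfin⟩
  have hint : Integrable (momentBound H g B) μ := hY.norm.integrable_mul hDm
  refine ⟨hint, ?_⟩
  have hholder := eLpNorm_smul_le_mul_eLpNorm (p := p) (q := ENNReal.ofReal q) (r := 1) hDm.1 hY.norm.1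
  rw [eLpNorm_norm] at hholder
  have h1 : ∫ x, momentBound H g B x ∂μ = (eLpNorm (momentBound H g B) 1 μ).toReal := by
    rw [eLpNorm_one_eq_lintegral_enorm, integral_eq_lintegral_of_nonneg_ae
      (ae_of_all _ fun x => momentBound_nonneg x) hint.1]
    congr 1
    refine lintegral_congr fun x => ?_
    rw [Real.enorm_eq_ofReal (momentBound_nonneg x)]
  rw [h1]
  have h2 : eLpNorm (momentBound H g B) 1 μ ≤ eLpNorm (tensorSquare (integrandProcess g B)) p μ *
      (regSqNorm q d * ENNReal.ofReal (3 * (2 / (1 - (2 - 2 * H) * q)) ^ (1 / q) *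
        (v - u) ^ (2 * (H - 1) + 2 / q))) :=
    hholder.trans (mul_le_mul_right hD _)
  have h3 := ENNReal.toReal_mono (ENNReal.mul_lt_top hY.2 hfin).ne h2
  rwa [ENNReal.toReal_mul, ENNReal.toReal_mul, ENNReal.toReal_ofReal (by positivity)] at h3

/-- Pointwise bound and convergence of the second moment kernels. -/
lemma IsFBM.moment_kernel (hH : 1 / 2 < H) (hH' : H < 1) (hB : IsFBM P H d B)
    (hm : Measurable (Function.uncurry B)) (hg : Measurable (Function.uncurry g)) (i j : Fin d)
    {s t : ℝ} (hx1 : 0 < s) (hx2 : 0 < t) (hx : s ≠ t)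
    (hint : Integrable (fun ω => momentBound H g B (ω, (s, t))) P) :
    (∀ ε δ : ℝ, 0 < ε → 0 < δ → |(ε * δ)⁻¹ * ∫ ω, momentIntegrand g B i j ε δ (ω, (s, t)) ∂P| ≤
      kernelConst H * ∫ ω, momentBound H g B (ω, (s, t)) ∂P) ∧
    ∃ L, Tendsto (fun r : ℝ × ℝ => (r.1 * r.2)⁻¹ *
      ∫ ω, momentIntegrand g B i j r.1 r.2 (ω, (s, t)) ∂P) (𝓝[>] 0 ×ˢ 𝓝[>] 0) (𝓝 L) := by
  obtain ⟨Φ, hΦ⟩ : ∃ Φ : Ω → ℝ, Φ = fun ω =>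
      integrandProcess g B s ω i * integrandProcess g B t ω j := ⟨_, rfl⟩
  obtain ⟨W, hWdef⟩ : ∃ W, W = kernelWeight H s t := ⟨_, rfl⟩
  have hm1 : ∀ ε δ ω, momentIntegrand g B i j ε δ (ω, (s, t)) =
      Φ ω * (increment B i ε s ω * increment B j δ t ω) := fun ε δ ω => by
    rw [hΦ, momentIntegrand]
  have hm2 : ∀ ω, momentBound H g B (ω, (s, t)) =
      ‖tensorSquare (integrandProcess g B) (ω, (s, t))‖ * (W * (1 + regSq H B s t ω)) := fun ω => by
    rw [hWdef, momentBound]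
  have hm3 : ∀ ω, |Φ ω| ≤ ‖tensorSquare (integrandProcess g B) (ω, (s, t))‖ := fun ω => by
    rw [hΦ]; exact abs_mul_le_norm_tensor _ _ i j
  have hΦφ : Φ = fun ω => (fun z : EuclideanSpace ℝ (Fin d) × EuclideanSpace ℝ (Fin d) =>
      g s z.1 i * g t z.2 j) (B s.toNNReal ω, B t.toNNReal ω) := hΦ
  have hW : 0 < W := by
    rw [hWdef, kernelWeight]
    have h1 : 0 < |s| ^ (2 * H - 2) := Real.rpow_pos_of_pos (abs_pos.2 hx1.ne') _
    have h2 : 0 ≤ |t| ^ (2 * H - 2) := by positivity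
    have h3 : 0 ≤ |t - s| ^ (2 * H - 2) := by positivity
    linarith
  have mg : ∀ r : ℝ, Measurable fun y => g r y := fun r => hg.comp measurable_prodMk_left
  have hφ : Measurable fun z : EuclideanSpace ℝ (Fin d) × EuclideanSpace ℝ (Fin d) =>
      g s z.1 i * g t z.2 j := by
    have h1 : Measurable fun z : EuclideanSpace ℝ (Fin d) × EuclideanSpace ℝ (Fin d) => g s z.1 :=
      (mg s).comp measurable_fst
    have h2 : Measurable fun z : EuclideanSpace ℝ (Fin d) × EuclideanSpace ℝ (Fin d) => g t z.2 :=
      (mg t).comp measurable_snd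
    fun_prop
  have mg' : ∀ r : ℝ, Measurable fun ω => integrandProcess g B r ω := fun r =>
    measurable_integrandProcess (h := fun ω : Ω => ω) (f := fun _ => r) hm hg measurable_const
      measurable_id
  have mΦ : Measurable Φ := by
    have h1 : Measurable fun ω => integrandProcess g B s ω i := by have := mg' s; fun_prop
    have h2 : Measurable fun ω => integrandProcess g B t ω j := by have := mg' t; fun_prop
    rw [hΦ]
    exact h1.mul h2
  have mS : Measurable fun ω => regSq H B s t ω := by
    have h : Measurable fun ω : Ω => (ω, (s, t)) := measurable_prodMk_right
    have h' := (measurable_regSq (H := H) hm).comp h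
    simpa only [Function.comp_def] using h'
  have hle : ∀ ω, |Φ ω| * (W * (1 + regSq H B s t ω)) ≤ momentBound H g B (ω, (s, t)) := by
    intro ω
    have := regSq_nonneg (H := H) (B := B) s t ω
    rw [hm2]
    exact mul_le_mul_of_nonneg_right (hm3 ω) (by positivity)
  simp only [hm1]
  -- Dividing the majorant by `W > 0` leaves a bound for `|Φ| (1 + regSq)`, hence for both `|Φ|` and
  -- `|Φ| regSq`.
  have hdom := hint.const_mul W⁻¹
  have hi : Integrable Φ P := by
    refine hdom.mono' mΦ.aestronglyMeasurable (ae_of_all _ fun ω => ?_)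
    have := regSq_nonneg (H := H) (B := B) s t ω
    rw [inv_mul_eq_div, le_div_iff₀ hW]
    refine le_trans ?_ (hle ω)
    rw [Real.norm_eq_abs]
    exact mul_le_mul_of_nonneg_left (le_mul_of_one_le_right hW.le (by linarith)) (abs_nonneg _)
  have hS : Integrable (fun ω => Φ ω * regSq H B s t ω) P := by
    refine hdom.mono' (mΦ.mul mS).aestronglyMeasurable (ae_of_all _ fun ω => ?_)
    have := regSq_nonneg (H := H) (B := B) s t ω
    rw [inv_mul_eq_div, le_div_iff₀ hW]
    refine le_trans ?_ (hle ω)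
    rw [Real.norm_eq_abs, abs_mul, abs_of_nonneg this, mul_assoc]
    rw [mul_comm _ W]
    exact mul_le_mul_of_nonneg_left (mul_le_mul_of_nonneg_left (by linarith) hW.le) (abs_nonneg _)
  refine ⟨fun ε δ hε hδ => ?_,
    hB.tendsto_integral_mul_increments hH hH' hx1 hx2 hx i j hφ hΦφ hi hS⟩
  have h1 := hB.abs_integral_mul_increments_le hH hH' hx1 hx2 hx i j hφ hΦφ hi hS
    hε.le hδ.le
  rw [abs_mul, abs_of_pos (by positivity : 0 < (ε * δ)⁻¹), inv_mul_le_iff₀ (by positivity)]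
  refine h1.trans (mul_le_mul_of_nonneg_left ?_ (by positivity))
  rw [mul_assoc, ← hWdef]
  refine mul_le_mul_of_nonneg_left ?_ (kernelConst_pos hH).le
  rw [← integral_const_mul]
  refine integral_mono_of_nonneg (ae_of_all _ fun ω => ?_) hint (ae_of_all _ fun ω => ?_)
  · have := regSq_nonneg (H := H) (B := B) s t ω
    simp only [Pi.zero_apply]; positivity
  · refine le_trans (le_of_eq ?_) (hle ω)
    simp only; ring

end SecondMoments

/-- By Tonelli the double integral of absolute values is the square of the single one. -/
lemma integrable_of_integrable_mul_self_prod {X : Type*} [MeasurableSpace X] {ν : Measure X}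
    [SFinite ν] {f : X → ℝ} (hf : Measurable f)
    (h : Integrable (fun x : X × X => f x.1 * f x.2) (ν.prod ν)) : Integrable f ν := by
  refine ⟨hf.aestronglyMeasurable, ?_⟩
  have h1 : ∫⁻ x : X × X, ‖f x.1‖ₑ * ‖f x.2‖ₑ ∂ν.prod ν < ∞ := by
    simpa only [HasFiniteIntegral, enorm_mul] using h.2
  rw [lintegral_prod_mul hf.enorm.aemeasurable hf.enorm.aemeasurable] at h1
  by_contra h2
  have h3 : ∫⁻ x, ‖f x‖ₑ ∂ν = ∞ := by
    simpa only [HasFiniteIntegral, not_lt, top_le_iff] using h2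
  simp [h3] at h1

lemma intervalIntegral_eq_integral_Icc {u v : ℝ} (huv : u ≤ v) (f : ℝ → ℝ) :
    ∫ s in u..v, f s = ∫ s in Set.Icc u v, f s := by
  rw [intervalIntegral.integral_of_le huv, integral_Icc_eq_integral_Ioc]

lemma forwardApprox_mul_forwardApprox {Ω : Type*} {d : ℕ}
    (B : ℝ≥0 → Ω → EuclideanSpace ℝ (Fin d)) (Y : ℝ → Ω → EuclideanSpace ℝ (Fin d))
    {u v : ℝ} (huv : u ≤ v) (ε δ : ℝ) (ω : Ω) :
    forwardApprox B Y u v ε ω * forwardApprox B Y u v δ ω =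
      (ε * δ)⁻¹ * ∫ x in Set.Icc u v ×ˢ Set.Icc u v,
        forwardIntegrand B Y ε ω x.1 * forwardIntegrand B Y δ ω x.2 := by
  rw [volume_restrict_Icc_prod, integral_prod_mul, forwardApprox, forwardApprox,
    intervalIntegral_eq_integral_Icc huv, intervalIntegral_eq_integral_Icc huv, mul_inv]
  ring

/-! ### Convergence for jointly measurable paths. -/

section ForwardIntegral

variable {Ω : Type*} [MeasurableSpace Ω] {P : Measure Ω} {H : ℝ} {d : ℕ}
  {B : ℝ≥0 → Ω → EuclideanSpace ℝ (Fin d)}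
  {g : ℝ → EuclideanSpace ℝ (Fin d) → EuclideanSpace ℝ (Fin d)}
  {p : ℝ≥0∞} {q u v : ℝ}

lemma IsFBM.integrable_forwardIntegrand_mul (hH : 0 < H) (hB : IsFBM P H d B)
    (hm : Measurable (Function.uncurry B)) (hg : Measurable (Function.uncurry g))
    (hpq : ENNReal.HolderConjugate p (ENNReal.ofReal q)) (hq : 1 ≤ q) (hu : 0 ≤ u)
    (hY : MemLp (tensorSquare (integrandProcess g B)) p
      (P.prod (volume.restrict (Set.Icc u v ×ˢ Set.Icc u v))))
    {ε δ : ℝ} (hε : 0 < ε) (hδ : 0 < δ) :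
    Integrable (fun y : Ω × (ℝ × ℝ) =>
      forwardIntegrand B (integrandProcess g B) ε y.1 y.2.1 *
        forwardIntegrand B (integrandProcess g B) δ y.1 y.2.2)
      (P.prod (volume.restrict (Set.Icc u v ×ˢ Set.Icc u v))) := by
  simp only [forwardIntegrand_mul_forwardIntegrand]
  exact integrable_finsetSum _ fun i _ => integrable_finsetSum _ fun j _ =>
    hB.integrable_momentIntegrand hH hm hg hpq hq hu hY i j hε hδ

/-- Only the tensor square of the integrand is assumed integrable, so pathwise integrability is read
off from the product of the forward integrand with itself on almost every section of the square. -/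
lemma IsFBM.ae_intervalIntegrable_forwardIntegrand (hH : 0 < H) (hB : IsFBM P H d B)
    (hm : Measurable (Function.uncurry B)) (hg : Measurable (Function.uncurry g))
    (hpq : ENNReal.HolderConjugate p (ENNReal.ofReal q)) (hq : 1 ≤ q) (hu : 0 ≤ u) (huv : u ≤ v)
    (hY : MemLp (tensorSquare (integrandProcess g B)) p
      (P.prod (volume.restrict (Set.Icc u v ×ˢ Set.Icc u v)))) {ε : ℝ} (hε : 0 < ε) :
    ∀ᵐ ω ∂P, IntervalIntegrable (forwardIntegrand B (integrandProcess g B) ε ω) volume u v := by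
  have := hB.isProbabilityMeasure
  have h := (hB.integrable_forwardIntegrand_mul hH hm hg hpq hq hu hY hε hε).prod_right_ae
  filter_upwards [h] with ω hω
  rw [volume_restrict_Icc_prod] at hω
  have h1 : Measurable (forwardIntegrand B (integrandProcess g B) ε ω) := by
    have h2 : Measurable fun s : ℝ => (ω, s) := measurable_prodMk_left
    have h3 := (measurable_forwardIntegrand hm hg ε).comp h2
    simpa only [Function.comp_def] using h3
  rw [intervalIntegrable_iff_integrableOn_Icc_of_le huv]
  exact integrable_of_integrable_mul_self_prod h1 hω

lemma IsFBM.memLp_forwardApprox (hH : 0 < H) (hB : IsFBM P H d B)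
    (hm : Measurable (Function.uncurry B)) (hg : Measurable (Function.uncurry g))
    (hpq : ENNReal.HolderConjugate p (ENNReal.ofReal q)) (hq : 1 ≤ q) (hu : 0 ≤ u) (huv : u ≤ v)
    (hY : MemLp (tensorSquare (integrandProcess g B)) p
      (P.prod (volume.restrict (Set.Icc u v ×ˢ Set.Icc u v)))) {ε : ℝ} (hε : 0 < ε) :
    MemLp (forwardApprox B (integrandProcess g B) u v ε) 2 P := by
  have := hB.isProbabilityMeasure
  have h1 : StronglyMeasurable (forwardApprox B (integrandProcess g B) u v ε) := by
    unfold forwardApprox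
    simp only [intervalIntegral_eq_integral_Icc huv]
    have h := (measurable_forwardIntegrand hm hg ε).stronglyMeasurable.integral_prod_right'
      (ν := volume.restrict (Set.Icc u v))
    exact h.const_mul _
  rw [memLp_two_iff_integrable_sq h1.aestronglyMeasurable]
  simp only [sq, forwardApprox_mul_forwardApprox B _ huv]
  exact (hB.integrable_forwardIntegrand_mul hH hm hg hpq hq hu hY hε hε).integral_prod_left.const_mul
    _

lemma IsFBM.integral_forwardApprox_mul (hH : 0 < H) (hB : IsFBM P H d B)
    (hm : Measurable (Function.uncurry B)) (hg : Measurable (Function.uncurry g))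
    (hpq : ENNReal.HolderConjugate p (ENNReal.ofReal q)) (hq : 1 ≤ q) (hu : 0 ≤ u) (huv : u ≤ v)
    (hY : MemLp (tensorSquare (integrandProcess g B)) p
      (P.prod (volume.restrict (Set.Icc u v ×ˢ Set.Icc u v)))) {ε δ : ℝ} (hε : 0 < ε)
    (hδ : 0 < δ) :
    ∫ ω, forwardApprox B (integrandProcess g B) u v ε ω *
        forwardApprox B (integrandProcess g B) u v δ ω ∂P =
      ∑ i, ∑ j, ∫ x in Set.Icc u v ×ˢ Set.Icc u v,
        (ε * δ)⁻¹ * ∫ ω, momentIntegrand g B i j ε δ (ω, x) ∂P := by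
  have := hB.isProbabilityMeasure
  have hi := fun i j => hB.integrable_momentIntegrand hH hm hg hpq hq hu hY i j hε hδ
  simp only [forwardApprox_mul_forwardApprox B _ huv]
  rw [integral_const_mul, ← integral_prod
    (fun y : Ω × (ℝ × ℝ) => forwardIntegrand B (integrandProcess g B) ε y.1 y.2.1 *
      forwardIntegrand B (integrandProcess g B) δ y.1 y.2.2)
    (hB.integrable_forwardIntegrand_mul hH hm hg hpq hq hu hY hε hδ)]
  simp only [forwardIntegrand_mul_forwardIntegrand]
  rw [integral_finsetSum _ fun i _ => integrable_finsetSum _ fun j _ => hi i j, Finset.mul_sum]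
  refine Finset.sum_congr rfl fun i _ => ?_
  rw [integral_finsetSum _ fun j _ => hi i j, Finset.mul_sum]
  refine Finset.sum_congr rfl fun j _ => ?_
  rw [integral_const_mul, ← integral_prod_symm _ (hi i j)]

/-- Dominated convergence along the product filter, with the majorant `kernelConst H *
E[momentBound]`. Its integral survives the limit and bounds `c`. -/
lemma IsFBM.tendsto_integral_moment (hH : 1 / 2 < H) (hH' : H < 1) (hB : IsFBM P H d B)
    (hm : Measurable (Function.uncurry B)) (hg : Measurable (Function.uncurry g))
    (hpq : ENNReal.HolderConjugate p (ENNReal.ofReal q)) (hq : 1 ≤ q)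
    (hqH : (2 - 2 * H) * q < 1) (hu : 0 ≤ u) (huv : u ≤ v)
    (hY : MemLp (tensorSquare (integrandProcess g B)) p
      (P.prod (volume.restrict (Set.Icc u v ×ˢ Set.Icc u v)))) (i j : Fin d) :
    ∃ c, c ≤ kernelConst H * ∫ x, momentBound H g B x
        ∂(P.prod (volume.restrict (Set.Icc u v ×ˢ Set.Icc u v))) ∧
      Tendsto (fun r : ℝ × ℝ => ∫ x in Set.Icc u v ×ˢ Set.Icc u v,
        (r.1 * r.2)⁻¹ * ∫ ω, momentIntegrand g B i j r.1 r.2 (ω, x) ∂P)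
        (𝓝[>] 0 ×ˢ 𝓝[>] 0) (𝓝 c) := by
  have := hB.isProbabilityMeasure
  have hD := (hB.integrable_momentBound hH hH' hm hpq hq hqH hu huv hY).1
  rw [integral_prod_symm _ hD, ← integral_const_mul]
  have hpos : ∀ᶠ r : ℝ × ℝ in 𝓝[>] 0 ×ˢ 𝓝[>] 0, 0 < r.1 ∧ 0 < r.2 :=
    (eventually_mem_nhdsWithin (α := ℝ)).prod_mk eventually_mem_nhdsWithin
  have hker : ∀ᵐ x ∂(volume : Measure (ℝ × ℝ)).restrict (Set.Icc u v ×ˢ Set.Icc u v),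
      (∀ ε δ : ℝ, 0 < ε → 0 < δ → |(ε * δ)⁻¹ * ∫ ω, momentIntegrand g B i j ε δ (ω, x) ∂P| ≤
        kernelConst H * ∫ ω, momentBound H g B (ω, x) ∂P) ∧
      ∃ L, Tendsto (fun r : ℝ × ℝ => (r.1 * r.2)⁻¹ *
        ∫ ω, momentIntegrand g B i j r.1 r.2 (ω, x) ∂P) (𝓝[>] 0 ×ˢ 𝓝[>] 0) (𝓝 L) := by
    filter_upwards [ae_restrict_Icc_prod hu v, hD.prod_left_ae] with x hx hx'
    exact hB.moment_kernel hH hH' hm hg i j hx.1 hx.2.1 hx.2.2 hx'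
  -- A limit function must be defined everywhere; where the kernel does not converge, a null set by
  -- `hker`, the value is 0.
  have hlim : ∀ x : ℝ × ℝ, ∃ L, (∃ L, Tendsto (fun r : ℝ × ℝ => (r.1 * r.2)⁻¹ *
        ∫ ω, momentIntegrand g B i j r.1 r.2 (ω, x) ∂P) (𝓝[>] 0 ×ˢ 𝓝[>] 0) (𝓝 L)) →
      Tendsto (fun r : ℝ × ℝ => (r.1 * r.2)⁻¹ *
        ∫ ω, momentIntegrand g B i j r.1 r.2 (ω, x) ∂P) (𝓝[>] 0 ×ˢ 𝓝[>] 0) (𝓝 L) := by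
    intro x
    by_cases h : ∃ L, Tendsto (fun r : ℝ × ℝ => (r.1 * r.2)⁻¹ *
        ∫ ω, momentIntegrand g B i j r.1 r.2 (ω, x) ∂P) (𝓝[>] 0 ×ˢ 𝓝[>] 0) (𝓝 L)
    · exact ⟨h.choose, fun _ => h.choose_spec⟩
    · exact ⟨0, fun h' => (h h').elim⟩
  choose L hL using hlim
  have hbound : Integrable (fun x => kernelConst H * ∫ ω, momentBound H g B (ω, x) ∂P)
      ((volume : Measure (ℝ × ℝ)).restrict (Set.Icc u v ×ˢ Set.Icc u v)) :=
    hD.integral_prod_right.const_mul _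
  have htends := tendsto_integral_filter_of_dominated_convergence
    (F := fun (r : ℝ × ℝ) (x : ℝ × ℝ) => (r.1 * r.2)⁻¹ *
        ∫ ω, momentIntegrand g B i j r.1 r.2 (ω, x) ∂P) (f := L)
    (l := 𝓝[>] 0 ×ˢ 𝓝[>] 0)
    (μ := (volume : Measure (ℝ × ℝ)).restrict (Set.Icc u v ×ˢ Set.Icc u v))
    (fun x => kernelConst H * ∫ ω, momentBound H g B (ω, x) ∂P)
    (by
      filter_upwards [hpos] with r hr
      exact ((hB.integrable_momentIntegrand (by linarith) hm hg hpq hq hu hY i j hr.1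
        hr.2).integral_prod_right.const_mul _).1)
    (by
      filter_upwards [hpos] with r hr
      filter_upwards [hker] with x hx
      exact hx.1 _ _ hr.1 hr.2)
    hbound
    (by filter_upwards [hker] with x hx using hL x hx.2)
  refine ⟨_, le_of_tendsto htends ?_, htends⟩
  filter_upwards [hpos] with r hr
  refine integral_mono_ae ((hB.integrable_momentIntegrand (by linarith) hm hg hpq hq hu hY i j hr.1
        hr.2).integral_prod_right.const_mul _) hbound ?_
  filter_upwards [hker] with x hx
  exact (le_abs_self _).trans (hx.1 _ _ hr.1 hr.2)

/-- The factor in front of `‖Y ⊗ Y‖_p |v - u|^(2(H-1)+2/q)` in the estimate of the forward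
integral. -/
noncomputable def forwardConst (H q : ℝ) (d : ℕ) : ℝ :=
  d ^ 2 * (kernelConst H * ((regSqNorm q d).toReal *
    (3 * (2 / (1 - (2 - 2 * H) * q)) ^ (1 / q))))

lemma forwardConst_nonneg (hH : 1 / 2 < H) (hqH : (2 - 2 * H) * q < 1) :
    0 ≤ forwardConst H q d := by
  have := kernelConst_pos hH
  have : 0 < 1 - (2 - 2 * H) * q := by linarith
  unfold forwardConst
  positivity

/-- Existence and `L²` estimate of the forward integral over `[u, v]`, `u ≤ v`, for a jointly
measurable fractional Brownian motion. -/
lemma IsFBM.exists_isForwardIntegral_of_measurable (hH : 1 / 2 < H) (hH' : H < 1)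
    (hB : IsFBM P H d B)
    (hm : Measurable (Function.uncurry B)) (hg : Measurable (Function.uncurry g))
    (hpq : ENNReal.HolderConjugate p (ENNReal.ofReal q)) (hq : 1 ≤ q)
    (hqH : (2 - 2 * H) * q < 1) (hu : 0 ≤ u) (huv : u ≤ v)
    (hY : MemLp (tensorSquare (integrandProcess g B)) p
      (P.prod (volume.restrict (Set.Icc u v ×ˢ Set.Icc u v)))) :
    ∃ I : Ω → ℝ, IsForwardIntegral P B (integrandProcess g B) u v I ∧
      (eLpNorm I 2 P).toReal ^ 2 ≤ forwardConst H q d *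
        (eLpNorm (tensorSquare (integrandProcess g B)) p
          (P.prod (volume.restrict (Set.Icc u v ×ˢ Set.Icc u v)))).toReal *
        (v - u) ^ (2 * (H - 1) + 2 / q) := by
  have hH0 : 0 < H := by linarith
  choose c hc hlim using fun i j =>
    hB.tendsto_integral_moment hH hH' hm hg hpq hq hqH hu huv hY i j
  have hpos : ∀ᶠ r : ℝ × ℝ in 𝓝[>] 0 ×ˢ 𝓝[>] 0, 0 < r.1 ∧ 0 < r.2 :=
    (eventually_mem_nhdsWithin (α := ℝ)).prod_mk eventually_mem_nhdsWithin
  have hprod : Tendsto (fun r : ℝ × ℝ => ∫ ω, forwardApprox B (integrandProcess g B) u v r.1 ω *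
      forwardApprox B (integrandProcess g B) u v r.2 ω ∂P) (𝓝[>] 0 ×ˢ 𝓝[>] 0)
      (𝓝 (∑ i, ∑ j, c i j)) := by
    refine (tendsto_finsetSum _ fun i _ => tendsto_finsetSum _ fun j _ => hlim i j).congr' ?_
    filter_upwards [hpos] with r hr
    exact (hB.integral_forwardApprox_mul hH0 hm hg hpq hq hu huv hY hr.1 hr.2).symm
  obtain ⟨I, hI, hI', hIc⟩ := exists_memLp_tendsto_of_tendsto_integral_mul
    (J := forwardApprox B (integrandProcess g B) u v) (l := 𝓝[>] (0 : ℝ))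
    (eventually_mem_nhdsWithin.mono fun ε hε =>
      hB.memLp_forwardApprox hH0 hm hg hpq hq hu huv hY hε) hprod
  refine ⟨I, ⟨hI, fun ε hε =>
    hB.ae_intervalIntegrable_forwardIntegrand hH0 hm hg hpq hq hu huv hY hε,
    fun ε hε => hB.memLp_forwardApprox hH0 hm hg hpq hq hu huv hY hε, hI'⟩, ?_⟩
  rw [hIc]
  have hD := (hB.integrable_momentBound hH hH' hm hpq hq hqH hu huv hY).2
  -- All `d²` coordinate pairs share one bound, which is the factor `d ^ 2` of `forwardConst`.
  calc ∑ i, ∑ j, c i j ≤ ∑ _i : Fin d, ∑ _j : Fin d, kernelConst H * _ :=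
        Finset.sum_le_sum fun i _ => Finset.sum_le_sum fun j _ =>
          (hc i j).trans (mul_le_mul_of_nonneg_left hD (kernelConst_pos hH).le)
    _ = _ := by
      simp only [Finset.sum_const, Finset.card_univ, Fintype.card_fin, nsmul_eq_mul, forwardConst]
      ring

end ForwardIntegral

/-! ### Passage to a jointly measurable version. -/

section Modification

variable {Ω : Type*} [MeasurableSpace Ω] {P : Measure Ω} {H : ℝ} {d : ℕ}
  {B B' : ℝ≥0 → Ω → EuclideanSpace ℝ (Fin d)}

lemma tendsto_floor_mul_succ_div (t : ℝ≥0) :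
    Tendsto (fun n : ℕ => ((⌊t * (n + 1)⌋₊ : ℝ≥0) / (n + 1))) atTop (𝓝 t) := by
  rw [← NNReal.tendsto_coe]
  have h := (tendsto_nat_floor_mul_div_atTop (R := ℝ) t.2).comp
    (tendsto_atTop_add_const_right _ (1 : ℝ) (tendsto_natCast_atTop_atTop (R := ℝ)))
  refine h.congr fun n => ?_
  simp only [Function.comp_apply, NNReal.coe_div, NNReal.coe_natCast, NNReal.coe_add,
    NNReal.coe_one]
  congr 3

/-- A process with almost surely continuous paths is indistinguishable from a jointly measurable
one. -/
lemma exists_measurable_uncurry_indistinguishable {E : Type*} [NormedAddCommGroup E]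
    [CompleteSpace E] [SecondCountableTopology E] [MeasurableSpace E] [BorelSpace E]
    {X : ℝ≥0 → Ω → E} (hX : ∀ t, AEMeasurable (X t) P)
    (hc : ∀ᵐ ω ∂P, Continuous fun t => X t ω) :
    ∃ X' : ℝ≥0 → Ω → E, Measurable (Function.uncurry X') ∧ ∀ᵐ ω ∂P, ∀ t, X t ω = X' t ω := by
  -- Only countably many times `k / (n + 1)` are sampled, so measurable versions can be chosen there
  -- off a single null set. The floor of `t (n + 1)` then gives jointly measurable step processes.
  let F : ℕ → ℕ × Ω → E := fun n z => (hX ((z.1 : ℝ≥0) / (n + 1))).mk _ z.2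
  have hF : ∀ n, Measurable (F n) := fun n =>
    measurable_from_prod_countable_right fun k => (hX ((k : ℝ≥0) / (n + 1))).measurable_mk
  obtain ⟨A, hA'⟩ : ∃ A : ℕ → ℝ≥0 × Ω → E, A = fun n => F n ∘
    fun z : ℝ≥0 × Ω => (⌊z.1 * (n + 1)⌋₊, z.2) := ⟨_, rfl⟩
  have hA : ∀ n, Measurable (A n) := fun n => by
    have h2 : Measurable fun z : ℝ≥0 × Ω => (⌊z.1 * (n + 1)⌋₊, z.2) :=
      (Nat.measurable_floor.comp (measurable_fst.mul_const _)).prodMk measurable_snd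
    rw [hA']
    exact (hF n).comp h2
  -- `limUnder` is measurable whether or not the sequence converges; on the almost sure event of
  -- continuity it equals `X t ω` at all times simultaneously.
  refine ⟨fun t ω => limUnder atTop fun n => A n (t, ω),
    (StronglyMeasurable.limUnder (l := atTop) (f := A)
      fun n => (hA n).stronglyMeasurable).measurable, ?_⟩
  have hmk : ∀ᵐ ω ∂P, ∀ n k : ℕ, X ((k : ℝ≥0) / (n + 1)) ω = (hX ((k : ℝ≥0) / (n + 1))).mk _ ω :=
    ae_all_iff.2 fun n => ae_all_iff.2 fun k => (hX _).ae_eq_mk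
  filter_upwards [hc, hmk] with ω h1 h2 t
  have h3 : Tendsto (fun n => A n (t, ω)) atTop (𝓝 (X t ω)) :=
    ((h1.tendsto t).comp (tendsto_floor_mul_succ_div t)).congr fun n => by
      rw [hA']; exact h2 n _
  exact h3.limUnder_eq.symm

lemma IsFBM.congr (hB : IsFBM P H d B) (h : ∀ᵐ ω ∂P, ∀ t, B t ω = B' t ω) :
    IsFBM P H d B' where
  isGaussianProcess := hB.isGaussianProcess.congr fun t => h.mono fun _ hω => hω t
  centered t i := by
    rw [← hB.centered t i]
    exact integral_congr_ae (h.mono fun ω hω => by simp only [hω t])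
  covariance s t i j := by
    rw [← hB.covariance s t i j]
    exact integral_congr_ae (h.mono fun ω hω => by simp only [hω t, hω s])
  continuous_paths := by
    filter_upwards [h, hB.continuous_paths] with ω h1 h2
    simpa only [h1] using h2

variable {Y Y' : ℝ → Ω → EuclideanSpace ℝ (Fin d)} {u v : ℝ} {I : Ω → ℝ}

lemma IsForwardIntegral.congr (hI : IsForwardIntegral P B Y u v I)
    (h : ∀ᵐ ω ∂P, ∀ t, B t ω = B' t ω) (hY : ∀ᵐ ω ∂P, ∀ t, Y t ω = Y' t ω) :
    IsForwardIntegral P B' Y' u v I := by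
  have h1 : ∀ ε, ∀ᵐ ω ∂P, forwardIntegrand B Y ε ω = forwardIntegrand B' Y' ε ω := fun ε => by
    filter_upwards [h, hY] with ω h1 h2
    funext s
    simp only [forwardIntegrand, h1, h2]
  have h2 : ∀ ε, forwardApprox B Y u v ε =ᵐ[P] forwardApprox B' Y' u v ε := fun ε => by
    filter_upwards [h1 ε] with ω hω
    simp only [forwardApprox, hω]
  refine ⟨hI.memLp_limit, fun ε hε => ?_, fun ε hε => (hI.memLp_approx ε hε).ae_eq (h2 ε), ?_⟩
  · filter_upwards [h1 ε, hI.intervalIntegrable ε hε] with ω h3 h4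
    rwa [← h3]
  · exact hI.tendsto.congr fun ε => eLpNorm_congr_ae ((h2 ε).sub (ae_eq_refl I))

lemma IsForwardIntegral.symm (hI : IsForwardIntegral P B Y u v I) :
    IsForwardIntegral P B Y v u (-I) := by
  have h : ∀ ε, forwardApprox B Y v u ε = -forwardApprox B Y u v ε := fun ε => by
    funext ω
    rw [forwardApprox, intervalIntegral.integral_symm, Pi.neg_apply, forwardApprox, mul_neg]
  refine ⟨hI.memLp_limit.neg, fun ε hε => ?_, fun ε hε => ?_, ?_⟩
  · filter_upwards [hI.intervalIntegrable ε hε] with ω hω using hω.symm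
  · rw [h]; exact (hI.memLp_approx ε hε).neg
  · refine hI.tendsto.congr fun ε => ?_
    rw [h, ← eLpNorm_neg]
    congr 1
    abel

end Modification

/-! ### Assembly of the theorem. -/

lemma IsFBM.exists_isForwardIntegral {Ω : Type*} [MeasurableSpace Ω] {P : Measure Ω} {H : ℝ}
    {d : ℕ} {B : ℝ≥0 → Ω → EuclideanSpace ℝ (Fin d)}
    {g : ℝ → EuclideanSpace ℝ (Fin d) → EuclideanSpace ℝ (Fin d)}
    {p : ℝ≥0∞} {q u v T : ℝ} (hH : 1 / 2 < H) (hH' : H < 1) (hB : IsFBM P H d B)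
    (hg : Measurable (Function.uncurry g))
    (hpq : ENNReal.HolderConjugate p (ENNReal.ofReal q)) (hq : 1 ≤ q)
    (hqH : (2 - 2 * H) * q < 1) (hu : 0 ≤ u) (huv : u ≤ v) (hv : v ≤ T)
    (hY : MemLp (tensorSquare (integrandProcess g B)) p (squareMeasure P T)) :
    ∃ I : Ω → ℝ, IsForwardIntegral P B (integrandProcess g B) u v I ∧
      (eLpNorm I 2 P).toReal ^ 2 ≤ forwardConst H q d *
        (eLpNorm (tensorSquare (integrandProcess g B)) p (squareMeasure P T)).toReal *
        (v - u) ^ (2 * (H - 1) + 2 / q) := by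
  have := hB.isProbabilityMeasure
  -- Fubini needs joint measurability, which almost sure continuity alone does not give.
  -- Indistinguishability, rather than mere modification, transfers whole paths and hence the
  -- forward integrands.
  obtain ⟨B', hm, hBB'⟩ := exists_measurable_uncurry_indistinguishable
    (fun t => hB.isGaussianProcess.aemeasurable t) hB.continuous_paths
  have hYY' : ∀ᵐ ω ∂P, ∀ s, integrandProcess g B s ω = integrandProcess g B' s ω := by
    filter_upwards [hBB'] with ω hω s
    simp only [integrandProcess, hω]
  have hle : P.prod ((volume : Measure (ℝ × ℝ)).restrict (Set.Icc u v ×ˢ Set.Icc u v)) ≤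
      squareMeasure P T :=
    Measure.prod_mono le_rfl (Measure.restrict_mono_set _
      (Set.prod_mono (Set.Icc_subset_Icc hu hv) (Set.Icc_subset_Icc hu hv)))
  have hte : tensorSquare (integrandProcess g B) =ᵐ[P.prod
      ((volume : Measure (ℝ × ℝ)).restrict (Set.Icc u v ×ˢ Set.Icc u v))]
      tensorSquare (integrandProcess g B') := by
    filter_upwards [Measure.quasiMeasurePreserving_fst.ae hYY'] with x hx
    simp only [tensorSquare, hx]
  have hY1 := hY.mono_measure hle
  obtain ⟨I, hI, hle'⟩ := (hB.congr hBB').exists_isForwardIntegral_of_measurable hH hH' hm hg hpq hq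
    hqH hu huv (hY1.ae_eq hte)
  refine ⟨I, hI.congr (hBB'.mono fun ω h t => (h t).symm) (hYY'.mono fun ω h t => (h t).symm),
    hle'.trans ?_⟩
  rw [← eLpNorm_congr_ae hte]
  have h0 : 0 ≤ v - u := by linarith
  refine mul_le_mul_of_nonneg_right (mul_le_mul_of_nonneg_left ?_
    (forwardConst_nonneg hH hqH)) (by positivity)
  exact ENNReal.toReal_mono hY.2.ne (eLpNorm_mono_measure _ hle)

lemma one_le_of_holderConjugate_ofReal {p : ℝ≥0∞} {q : ℝ}
    (hpq : ENNReal.HolderConjugate p (ENNReal.ofReal q)) : 1 ≤ q := by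
  have h := ENNReal.HolderConjugate.one_le (ENNReal.ofReal q) p
  rwa [ENNReal.one_le_ofReal] at h

/-- In terms of reciprocals, `1/p < a` forces `1/q > 1 - a`. Working with inverses in `ℝ≥0∞`
includes `p = ∞`. -/
lemma mul_lt_one_of_lt_of_holderConjugate {p : ℝ≥0∞} {q a : ℝ} (ha : 0 < a) (ha' : a < 1)
    (hp : ENNReal.ofReal (1 / a) < p) (hpq : ENNReal.HolderConjugate p (ENNReal.ofReal q)) :
    (1 - a) * q < 1 := by
  have hq := one_le_of_holderConjugate_ofReal hpq
  have hq0 : 0 < q := by linarith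
  have h := ENNReal.HolderConjugate.inv_add_inv_eq_one p (ENNReal.ofReal q)
  have h1 : p⁻¹ < ENNReal.ofReal a := by
    rw [ENNReal.inv_lt_iff_inv_lt, ← ENNReal.ofReal_inv_of_pos ha, ← one_div]
    exact hp
  have h2 : (1 : ℝ≥0∞) < ENNReal.ofReal (a + q⁻¹) := by
    rw [← h, ENNReal.ofReal_add ha.le (by positivity), ENNReal.ofReal_inv_of_pos hq0]
    exact ENNReal.add_lt_add_right (by simp [hq0]) h1
  rw [ENNReal.one_lt_ofReal] at h2
  have h3 : (1 - a) * q < q⁻¹ * q := mul_lt_mul_of_pos_right (by linarith) hq0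
  rwa [inv_mul_cancel₀ hq0.ne'] at h3

theorem corollary1 (H : ℝ) (hH : 1 / 2 < H) (hH' : H < 1) (d : ℕ) (p : ℝ≥0∞) (q : ℝ)
    (hp : ENNReal.ofReal (max (1 / (2 - 2 * H)) (1 / (2 * H - 1))) < p)
    (hpq : ENNReal.HolderConjugate p (ENNReal.ofReal q)) :
    ∃ C : ℝ, 0 < C ∧
      ∀ (Ω : Type*) [MeasurableSpace Ω] (P : Measure Ω) [IsProbabilityMeasure P]
        (B : ℝ≥0 → Ω → EuclideanSpace ℝ (Fin d)) (_ : IsFBM P H d B)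
        (T : ℝ) (_ : 0 < T)
        (g : ℝ → EuclideanSpace ℝ (Fin d) → EuclideanSpace ℝ (Fin d))
        (_ : Measurable (Function.uncurry g))
        (_ : MemLp (tensorSquare (integrandProcess g B)) p (squareMeasure P T))
        (u v : ℝ) (_ : u ∈ Set.Icc 0 T) (_ : v ∈ Set.Icc 0 T),
        ∃ I : Ω → ℝ,
          IsForwardIntegral P B (integrandProcess g B) u v I ∧
          (eLpNorm I 2 P).toReal ^ 2 ≤
            C * (eLpNorm (tensorSquare (integrandProcess g B)) p (squareMeasure P T)).toReal *
              |v - u| ^ (2 * (H - 1) + 2 / q) := by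
  have hq := one_le_of_holderConjugate_ofReal hpq
  have hqH : (2 - 2 * H) * q < 1 := by
    have := mul_lt_one_of_lt_of_holderConjugate (a := 2 * H - 1) (by linarith) (by linarith)
      ((ENNReal.ofReal_le_ofReal (le_max_right _ _)).trans_lt hp) hpq
    rwa [show 1 - (2 * H - 1) = 2 - 2 * H by ring] at this
  have hC := forwardConst_nonneg (d := d) hH hqH
  -- The summand 1 makes the constant positive also for `d = 0`, where `forwardConst` vanishes.
  refine ⟨forwardConst H q d + 1, by linarith, ?_⟩
  intro Ω _ P _ B hB T _ g hg hY u v hu hv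
  have hconst : ∀ a b : ℝ, 0 ≤ a → 0 ≤ b →
      forwardConst H q d * a * b ≤ (forwardConst H q d + 1) * a * b := fun a b ha hb =>
    mul_le_mul_of_nonneg_right (mul_le_mul_of_nonneg_right (by linarith) ha) hb
  rcases le_total u v with huv | hvu
  · obtain ⟨I, hI, hle⟩ := hB.exists_isForwardIntegral hH hH' hg hpq hq hqH hu.1 huv hv.2 hY
    rw [abs_of_nonneg (by linarith : 0 ≤ v - u)]
    exact ⟨I, hI, hle.trans (hconst _ _ ENNReal.toReal_nonneg
      (Real.rpow_nonneg (by linarith) _))⟩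
  · obtain ⟨I, hI, hle⟩ := hB.exists_isForwardIntegral hH hH' hg hpq hq hqH hv.1 hvu hu.2 hY
    rw [abs_sub_comm, abs_of_nonneg (by linarith : 0 ≤ u - v)]
    refine ⟨-I, hI.symm, ?_⟩
    rw [eLpNorm_neg]
    exact hle.trans (hconst _ _ ENNReal.toReal_nonneg (Real.rpow_nonneg (by linarith) _))
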